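/- Let $k\in\mathbb C$, $N\ge 1$, $\alpha=k+N-1$, and let $\mathfrak m\subset\mathfrak b$ and $\mathfrak l$ be the Lie algebras of strictly lower triangular, lower triangular and diagonal matrices in $\mathfrak{gl}_N$, with matrix units $e_{ij}$. Let $\kappa_{\mathfrak b}$ be the invariant symmetric form on $\mathfrak b$ with $\kappa_{\mathfrak b}(e_{ii'},e_{jj'})=\delta_{ii'}\delta_{jj'}(k+N)(\delta_{ij}-\tfrac1N)$, and let $\widehat{\mathfrak b}=\mathfrak b[t,t^{-1}]\oplus\mathbb C\mathbf 1$ be the Kac–Moody affinization with respect to $\kappa_{\mathfrak b}$, $x[r]=xt^r$. Let $V^k(\mathfrak b)$ be the universal affine vertex algebra, that is the $\widehat{\mathfrak b}$-module induced from the one-dimensional module of $\mathfrak b[t]\oplus\mathbb C\mathbf 1$ on which $\mathfrak b[t]$ acts by $0$ and $\mathbf 1$ by $1$; let $V^k(\mathfrak l)$ be defined likewise from $\mathfrak l$ and the restriction of $\kappa_{\mathfrak b}$. Let $V^k(\mathfrak a)\supset V^k(\mathfrak b)$ be the vertex superalgebra induced in the same way from the Lie superalgebra with even part $\widehat{\mathfrak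 b}$ and supercommutative odd part $\mathfrak m[t,t^{-1}]$, on which $\widehat{\mathfrak b}$ acts by the adjoint action ($\mathbf 1$ acts on the odd part by $0$); here $\mathfrak b[t]$ and $\mathfrak m[t]$ act by $0$ and $\mathbf 1$ by $1$ on the vacuum. Write $\psi_{ji}[m]=e_{ji}t^{m-1}$ for the odd elements, with $\psi_{ji}[m]=0$ unless $1\le i<j\le N$. Let $Q$ be the odd derivation of $V^k(\mathfrak a)$ with respect to the product $a_{(-1)}b$ which commutes with the translation operator and satisfies $$Q\,e_{ji}[-1]=\sum_{a=i}^{j-1}e_{ai}[-1]\psi_{ja}[0]-\sum_{a=i+1}^{j}\psi_{ai}[0]e_{ja}[-1]+\alpha\,\psi_{ji}[-1]+\psi_{j+1\,i}[0]-\psi_{j\,i-1}[0]\qquad(j\ge i),$$ $$Q\,\psi_{ji}[0]=\tfrac12\sum_{i<r<j}\big(\psi_{jr}[0]\psi_{ri}[0]-\psi_{ri}[0]\psi_{jr}[0]\big)\qquad(j>i).$$ The principal $\mathcal W$-algebra is $\mathcal W^k(\mathfrak{gl}_N)=\{v\in V^k(\mathfrak b): Qv=0\}$, and the Miura transformation $\nu:\mathcal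 W^k(\mathfrak{gl}_N)\to V^k(\mathfrak l)$ is the restriction of the homomorphism $V^k(\mathfrak b)\to V^k(\mathfrak l)$ induced by the projection $\mathfrak b\to\mathfrak l$. On $U(\mathfrak b[t^{-1}]t^{-1})\otimes\mathbb C[\tau]$, and likewise for $\mathfrak l$, use the associative algebra structure in which $[\tau,x[r]]=-r\,x[r-1]$. Let $B$ be the $N\times N$ matrix with diagonal entries $\alpha\tau+e_{ii}[-1]$, entries $e_{ij}[-1]$ for $i>j$, entries $-1$ at the places $(i,i+1)$, and $0$ elsewhere. Its column-determinant $\operatorname{cdet}B=\sum_\sigma\operatorname{sgn}\sigma\, B_{\sigma(1)1}\cdots B_{\sigma(N)N}$ has an expansion $$\operatorname{cdet}B=(\alpha\tau)^N+W^{(1)}(\alpha\tau)^{N-1}+\dots+W^{(N)},\qquad W^{(r)}\in U(\mathfrak b[t^{-1}]t^{-1}),\quad W^{(0)}=1,$$ where the $W^{(r)}$ are obtained by treating $\alpha\tau$ as an indeterminate $T$ with $[T,u]=\alpha[\tau,u]$ (for $\alpha\ne0$ they are determined by the displayed formula). Regarded as elements of $V^k(\mathfrak b)$, all $W^{(r)}$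 belong to $\mathcal W^k(\mathfrak{gl}_N)$, and $$\sum_{r=0}^{N}\nu(W^{(r)})(\alpha\tau)^{N-r}=\big(\alpha\tau+e_{11}[-1]\big)\cdots\big(\alpha\tau+e_{NN}[-1]\big),$$ where the right-hand side is computed in $U(\mathfrak l[t^{-1}]t^{-1})\otimes\mathbb C[\tau]$ and both sides are regarded as elements of $V^k(\mathfrak l)\otimes\mathbb C[\tau]$. The same identity holds with $\alpha\tau$ replaced on both sides by an indeterminate $T$ with $[T,u]=\alpha[\tau,u]$. -/

import Mathlib

open scoped TensorProduct
open LieAlgebra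

attribute [local instance 100] LieRing.ofAssociativeRing

noncomputable section

namespace PrincipalW

section General

/-- The operator `-d/dt` on the Laurent polynomials `ℂ[t, t⁻¹]`. -/
def negDeriv : AddMonoidAlgebra ℂ ℤ →ₗ[ℂ] AddMonoidAlgebra ℂ ℤ :=
  (AddMonoidAlgebra.basis ℤ ℂ).constr ℂ
    fun r => AddMonoidAlgebra.single (r - 1) (-(r : ℂ))

lemma negDeriv_single (r : ℤ) (c : ℂ) :
    negDeriv (AddMonoidAlgebra.single r c) = AddMonoidAlgebra.single (r - 1) (-(r : ℂ) * c) := by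
  have h : AddMonoidAlgebra.single r c = c • AddMonoidAlgebra.basis ℤ ℂ r := by
    rw [AddMonoidAlgebra.basis_apply, AddMonoidAlgebra.smul_single, smul_eq_mul, mul_one]
  rw [h, map_smul, negDeriv, Module.Basis.constr_basis, AddMonoidAlgebra.smul_single, smul_eq_mul,
    mul_comm]

lemma negDeriv_mul (f g : AddMonoidAlgebra ℂ ℤ) :
    negDeriv (f * g) = negDeriv f * g + f * negDeriv g := by
  induction f using AddMonoidAlgebra.induction_linear with
  | zero => simp
  | add f₁ f₂ h₁ h₂ => rw [add_mul, map_add, h₁, h₂, map_add]; ring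
  | single r c =>
    induction g using AddMonoidAlgebra.induction_linear with
    | zero => simp
    | add g₁ g₂ h₁ h₂ => rw [mul_add, map_add, h₁, h₂, map_add]; ring
    | single s d =>
      rw [AddMonoidAlgebra.single_mul_single, negDeriv_single, negDeriv_single, negDeriv_single,
        AddMonoidAlgebra.single_mul_single, AddMonoidAlgebra.single_mul_single,
        show r - 1 + s = r + s - 1 by ring, show r + (s - 1) = r + s - 1 by ring,
        ← AddMonoidAlgebra.single_add]
      congr 1
      push_cast
      ring

/-- The operator `-d/dt` on `M[t, t⁻¹]`. -/
def loopDeriv (M : Type*) [AddCommGroup M] [Module ℂ M] :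
    AddMonoidAlgebra ℂ ℤ ⊗[ℂ] M →ₗ[ℂ] AddMonoidAlgebra ℂ ℤ ⊗[ℂ] M :=
  negDeriv.rTensor M

lemma loopDeriv_lie {L M : Type*} [LieRing L] [LieAlgebra ℂ L] [AddCommGroup M] [Module ℂ M]
    [LieRingModule L M] [LieModule ℂ L M] (x : loopAlgebra ℂ ℤ L)
    (m : AddMonoidAlgebra ℂ ℤ ⊗[ℂ] M) :
    loopDeriv M ⁅x, m⁆ = ⁅loopDeriv L x, m⁆ + ⁅x, loopDeriv M m⁆ := by
  induction x using TensorProduct.induction_on with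
  | zero =>
    have h (n : AddMonoidAlgebra ℂ ℤ ⊗[ℂ] M) : ⁅(0 : loopAlgebra ℂ ℤ L), n⁆ = 0 := zero_lie n
    rw [map_zero, h, h, map_zero, add_zero]
  | add x y hx hy =>
    have h (a b : loopAlgebra ℂ ℤ L) (n : AddMonoidAlgebra ℂ ℤ ⊗[ℂ] M) :
      ⁅a + b, n⁆ = ⁅a, n⁆ + ⁅b, n⁆ := add_lie a b n
    rw [map_add, h, h, h, map_add, hx, hy]
    abel
  | tmul f x =>
    induction m using TensorProduct.induction_on with
    | zero =>
      have h (a : loopAlgebra ℂ ℤ L) : ⁅a, (0 : AddMonoidAlgebra ℂ ℤ ⊗[ℂ] M)⁆ = 0 := lie_zero a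
      rw [map_zero, h, h, map_zero, add_zero]
    | add m n hm hn =>
      have h (a : loopAlgebra ℂ ℤ L) (u v : AddMonoidAlgebra ℂ ℤ ⊗[ℂ] M) :
        ⁅a, u + v⁆ = ⁅a, u⁆ + ⁅a, v⁆ := lie_add a u v
      rw [map_add, h, h, h, map_add, hm, hn]
      abel
    | tmul g y =>
      simp only [loopDeriv, LinearMap.rTensor_tmul, ExtendScalars.bracket_tmul, negDeriv_mul,
        TensorProduct.add_tmul]

/-- An invariant symmetric bilinear form on a complex Lie algebra. -/
structure InvForm (L : Type*) [LieRing L] [LieAlgebra ℂ L] where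
  form : LinearMap.BilinForm ℂ L
  symm : ∀ x y, form x y = form y x
  inv : ∀ x y z, form ⁅x, y⁆ z = form x ⁅y, z⁆

variable {L : Type*} [LieRing L] [LieAlgebra ℂ L]

/-- The cocycle `(x t^r, y t^s) ↦ r δ_{r+s,0} κ(x, y)`. Mathlib's cocycle attached to a form `Φ` is
`Res f dg`, that is `s δ_{r+s,0} Φ(x, y)`, which for `Φ = -κ` is the wanted one. -/
def InvForm.cocycle (κ : InvForm L) :
    LieModule.Cohomology.twoCocycle ℂ (loopAlgebra ℂ ℤ L)
      (TrivialLieModule ℂ (loopAlgebra ℂ ℤ L) ℂ) :=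
  LoopAlgebra.twoCocycleOfBilinear ℂ ℤ L (-κ.form)
    (by
      intro x y z
      have h₁ := κ.inv y x z
      rw [← lie_skew] at h₁
      simp only [map_neg, LinearMap.neg_apply, neg_neg] at h₁ ⊢
      rw [← h₁])
    ⟨fun x y => by simp [κ.symm x y]⟩

/-- The Kac--Moody affinization `L[t, t⁻¹] ⊕ ℂ 𝟏` of `L` with respect to `κ`. -/
abbrev Aff (κ : InvForm L) := LieAlgebra.ofTwoCocycle κ.cocycle

/-- The element `x[r] = x t^r` of the affinization. -/
def mode (κ : InvForm L) (r : ℤ) (x : L) : Aff κ :=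
  ofProd κ.cocycle (AddMonoidAlgebra.single r 1 ⊗ₜ x, 0)

/-- The central element `𝟏` of the affinization. -/
def central (κ : InvForm L) : Aff κ :=
  ofProd κ.cocycle (0, (TrivialLieModule.equiv ℂ (loopAlgebra ℂ ℤ L) ℂ).symm 1)

lemma cocycle_single (κ : InvForm L) (r s : ℤ) (x y : L) :
    (κ.cocycle : loopAlgebra ℂ ℤ L →ₗ[ℂ] loopAlgebra ℂ ℤ L →ₗ[ℂ] _)
      (AddMonoidAlgebra.single r 1 ⊗ₜ x) (AddMonoidAlgebra.single s 1 ⊗ₜ y) =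
    (TrivialLieModule.equiv ℂ (loopAlgebra ℂ ℤ L) ℂ).symm
      (if r + s = 0 then (r : ℂ) * κ.form x y else 0) := by
  have : (κ.cocycle : loopAlgebra ℂ ℤ L →ₗ[ℂ] loopAlgebra ℂ ℤ L →ₗ[ℂ] _)
      (AddMonoidAlgebra.single r 1 ⊗ₜ x) (AddMonoidAlgebra.single s 1 ⊗ₜ y) =
    (TrivialLieModule.equiv ℂ (loopAlgebra ℂ ℤ L) ℂ).symm
      (LoopAlgebra.residuePairing ℂ ℤ L (-κ.form) (AddMonoidAlgebra.single r 1 ⊗ₜ x)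
        (AddMonoidAlgebra.single s 1 ⊗ₜ y)) := rfl
  rw [this]
  congr 1
  rw [LoopAlgebra.residuePairing_apply_apply, LoopAlgebra.toFinsupp_single_tmul,
    LoopAlgebra.toFinsupp_single_tmul, Finsupp.sum_single_index (by simp)]
  split_ifs with h
  · obtain rfl : r = -s := by linarith
    simp
  · rw [Finsupp.single_eq_of_ne (by omega)]
    simp

lemma lie_mode (κ : InvForm L) (r s : ℤ) (x y : L) :
    ⁅mode κ r x, mode κ s y⁆ =
      mode κ (r + s) ⁅x, y⁆ + (if r + s = 0 then (r : ℂ) * κ.form x y else 0) • central κ := by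
  rw [bracket_ofTwoCocycle]
  simp only [mode, central, Equiv.symm_apply_apply, lie_zero, sub_zero, add_zero,
    ExtendScalars.bracket_tmul, AddMonoidAlgebra.single_mul_single, one_mul,
    ← of_smul, ← of_add, cocycle_single]
  congr 1
  ext
  · split_ifs <;> simp
  · simp only [Prod.snd_add, Prod.smul_snd, ← map_smul, zero_add]
    simp

lemma mode_add (κ : InvForm L) (r : ℤ) (x y : L) : mode κ r (x + y) = mode κ r x + mode κ r y := by
  simp only [mode, TensorProduct.tmul_add, ← of_add, Prod.mk_add_mk, add_zero]

lemma mode_smul (κ : InvForm L) (r : ℤ) (c : ℂ) (x : L) :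
    mode κ r (c • x) = c • mode κ r x := by
  simp only [mode, TensorProduct.tmul_smul, ← of_smul, Prod.smul_mk, smul_zero]

lemma central_lie (κ : InvForm L) (x : Aff κ) : ⁅central κ, x⁆ = 0 := by
  rw [bracket_ofTwoCocycle]
  simp only [central, Equiv.symm_apply_apply, zero_lie, map_zero, LinearMap.zero_apply, zero_add,
    trivial_lie_zero, sub_zero]
  rfl

/-- The projection of the affinization onto the loop algebra. -/
def affProj (κ : InvForm L) : Aff κ →ₗ⁅ℂ⁆ loopAlgebra ℂ ℤ L where
  toFun x := ((ofProd κ.cocycle).symm x).1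
  map_add' _ _ := rfl
  map_smul' _ _ := rfl
  map_lie' {_ _} := rfl

/-- The elements `x[r]` and `𝟏` span the affinization. -/
lemma aff_induction (κ : InvForm L) {p : Aff κ → Prop} (x : Aff κ)
    (hmode : ∀ (r : ℤ) (y : L), p (mode κ r y)) (hc : p (central κ))
    (hadd : ∀ y z, p y → p z → p (y + z)) (hsmul : ∀ (c : ℂ) y, p y → p (c • y)) : p x := by
  have h0 : p 0 := by simpa using hsmul 0 _ hc
  obtain ⟨u, c⟩ := x
  have hx : (⟨(u, c)⟩ : Aff κ) = ofProd κ.cocycle (u, 0) +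
      (TrivialLieModule.equiv ℂ (loopAlgebra ℂ ℤ L) ℂ c) • central κ := by
    simp only [central, ← of_smul, ← of_add, Prod.smul_mk, smul_zero, ← map_smul, smul_eq_mul,
      mul_one, LinearEquiv.symm_apply_apply, Prod.mk_add_mk, add_zero, zero_add]
    rfl
  rw [hx]
  refine hadd _ _ ?_ (hsmul _ _ hc)
  clear hx
  induction u using TensorProduct.induction_on with
  | zero => exact h0
  | add u v hu hv =>
    have : ofProd κ.cocycle (u + v, 0) = ofProd κ.cocycle (u, 0) + ofProd κ.cocycle (v, 0) := by
      rw [← of_add, Prod.mk_add_mk, add_zero]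
    rw [this]
    exact hadd _ _ hu hv
  | tmul f y =>
    induction f using AddMonoidAlgebra.induction_linear with
    | zero => rw [TensorProduct.zero_tmul]; exact h0
    | add f g hf hg =>
      have : ofProd κ.cocycle ((f + g) ⊗ₜ[ℂ] y, 0) =
          ofProd κ.cocycle (f ⊗ₜ[ℂ] y, 0) + ofProd κ.cocycle (g ⊗ₜ[ℂ] y, 0) := by
        rw [← of_add, Prod.mk_add_mk, add_zero, TensorProduct.add_tmul]
      rw [this]
      exact hadd _ _ hf hg
    | single r a =>
      have : ofProd κ.cocycle (AddMonoidAlgebra.single r a ⊗ₜ[ℂ] y, 0) = a • mode κ r y := by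
        rw [mode, ← of_smul, Prod.smul_mk, smul_zero, TensorProduct.smul_tmul',
          AddMonoidAlgebra.smul_single, smul_eq_mul, mul_one]
      rw [this]
      exact hsmul _ _ (hmode r y)

/-- The operator `-d/dt` on the affinization, that is `ad τ`: it sends `x[r]` to `-r x[r-1]` and
kills `𝟏`. -/
def affDeriv (κ : InvForm L) : Aff κ →ₗ[ℂ] Aff κ where
  toFun x := ofProd κ.cocycle (loopDeriv L ((ofProd κ.cocycle).symm x).1, 0)
  map_add' x y := by
    rw [← of_add, of_symm_add, Prod.fst_add, map_add, Prod.mk_add_mk, add_zero]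
  map_smul' c x := by
    rw [RingHom.id_apply, ← of_smul, of_symm_smul, Prod.smul_fst, map_smul, Prod.smul_mk, smul_zero]

lemma affDeriv_mode (κ : InvForm L) (r : ℤ) (x : L) :
    affDeriv κ (mode κ r x) = -(r : ℂ) • mode κ (r - 1) x := by
  change ofProd κ.cocycle (loopDeriv L (AddMonoidAlgebra.single r 1 ⊗ₜ x), 0) = _
  rw [loopDeriv, LinearMap.rTensor_tmul, negDeriv_single, mode, ← of_smul, Prod.smul_mk, smul_zero,
    TensorProduct.smul_tmul', AddMonoidAlgebra.smul_single, smul_eq_mul]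

lemma affDeriv_central (κ : InvForm L) : affDeriv κ (central κ) = 0 := by
  change ofProd κ.cocycle (loopDeriv L 0, 0) = _
  rw [map_zero]
  rfl

lemma affDeriv_lie (κ : InvForm L) (x y : Aff κ) :
    affDeriv κ ⁅x, y⁆ = ⁅affDeriv κ x, y⁆ + ⁅x, affDeriv κ y⁆ := by
  induction x using aff_induction κ with
  | hc => rw [central_lie, affDeriv_central, central_lie, zero_lie, map_zero, add_zero]
  | hadd u v hu hv => rw [add_lie, map_add, hu, hv, map_add, add_lie, add_lie]; abel
  | hsmul c u hu => rw [smul_lie, map_smul, hu, map_smul, smul_lie, smul_lie, smul_add]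
  | hmode r x =>
    induction y using aff_induction κ with
    | hc =>
      rw [affDeriv_central, ← lie_skew, central_lie, ← lie_skew, central_lie, lie_zero, neg_zero,
        map_zero, add_zero]
    | hadd u v hu hv => rw [lie_add, map_add, hu, hv, map_add, lie_add, lie_add]; abel
    | hsmul c u hu => rw [lie_smul, map_smul, hu, map_smul, lie_smul, lie_smul, smul_add]
    | hmode s y =>
      rw [lie_mode, map_add, map_smul, affDeriv_mode, affDeriv_mode, affDeriv_mode,
        affDeriv_central, smul_zero, add_zero, smul_lie, lie_smul, lie_mode, lie_mode,
        show r - 1 + s = r + s - 1 by ring, show r + (s - 1) = r + s - 1 by ring,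
        smul_add, smul_add, smul_smul, smul_smul]
      have h : (-(r : ℂ) * if r + s - 1 = 0 then ((r - 1 : ℤ) : ℂ) * κ.form x y else 0) +
          (-(s : ℂ) * if r + s - 1 = 0 then (r : ℂ) * κ.form x y else 0) = 0 := by
        split_ifs with h
        · obtain rfl : s = 1 - r := by omega
          push_cast
          ring
        · simp
      push_cast at h ⊢
      linear_combination (norm := module) (-h) • central κ

/-- A derivation of a (noncommutative) complex algebra. -/
structure AlgDer (A : Type*) [Ring A] [Algebra ℂ A] where
  toLin : A →ₗ[ℂ] A
  leibniz : ∀ a b, toLin (a * b) = toLin a * b + a * toLin b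

/-- A multiple of a derivation. -/
def AlgDer.smul {A : Type*} [Ring A] [Algebra ℂ A] (c : ℂ) (δ : AlgDer A) : AlgDer A where
  toLin := c • δ.toLin
  leibniz a b := by simp [δ.leibniz]

/-- The derivation of `A` given by an algebra homomorphism `a ↦ a + ε δ(a)` to the dual numbers. -/
def AlgDer.ofDual {A : Type*} [Ring A] [Algebra ℂ A] (F : A →ₐ[ℂ] DualNumber A)
    (h : ∀ a, (F a).fst = a) : AlgDer A where
  toLin :=
    { toFun a := (F a).snd
      map_add' a b := by simp
      map_smul' c a := by simp }
  leibniz a b := by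
    simp only [LinearMap.coe_mk, AddHom.coe_mk, map_mul, TrivSqZeroExt.snd_mul, h]
    simp [add_comm]

/-- The derivation of the universal enveloping algebra which extends a derivation of the Lie
algebra. -/
def envDeriv (d : L →ₗ[ℂ] L) (hd : ∀ x y, d ⁅x, y⁆ = ⁅d x, y⁆ + ⁅x, d y⁆) :
    AlgDer (UniversalEnvelopingAlgebra ℂ L) :=
  let f : L →ₗ⁅ℂ⁆ DualNumber (UniversalEnvelopingAlgebra ℂ L) :=
    { toFun x := TrivSqZeroExt.inl (UniversalEnvelopingAlgebra.ι ℂ x) +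
        TrivSqZeroExt.inr (UniversalEnvelopingAlgebra.ι ℂ (d x))
      map_add' x y := by ext <;> simp
      map_smul' c x := by ext <;> simp
      map_lie' {x y} := by
        rw [LieRing.of_associative_ring_bracket]
        ext
        · simp [LieRing.of_associative_ring_bracket]
        · simp only [TrivSqZeroExt.snd_add, TrivSqZeroExt.snd_inl, TrivSqZeroExt.snd_inr,
            TrivSqZeroExt.snd_sub, TrivSqZeroExt.snd_mul, TrivSqZeroExt.fst_add,
            TrivSqZeroExt.fst_inl, TrivSqZeroExt.fst_inr, hd, map_add, LieHom.map_lie,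
            LieRing.of_associative_ring_bracket]
          simp
          abel }
  AlgDer.ofDual (UniversalEnvelopingAlgebra.lift ℂ f) fun a => by
    have : (TrivSqZeroExt.fstHom ℂ _ _).comp (UniversalEnvelopingAlgebra.lift ℂ f) =
        AlgHom.id ℂ _ := by
      ext x
      simp [f]
    exact congrArg (fun g => g a) this

lemma envDeriv_ι (d : L →ₗ[ℂ] L) (hd : ∀ x y, d ⁅x, y⁆ = ⁅d x, y⁆ + ⁅x, d y⁆) (x : L) :
    (envDeriv d hd).toLin (UniversalEnvelopingAlgebra.ι ℂ x) =
      UniversalEnvelopingAlgebra.ι ℂ (d x) := by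
  simp [envDeriv, AlgDer.ofDual]

/-- The Lie subalgebra `L[t⁻¹]t⁻¹` of the affinization. -/
def negPart (κ : InvForm L) : LieSubalgebra ℂ (Aff κ) where
  __ := Submodule.span ℂ {u | ∃ r : ℤ, r < 0 ∧ ∃ x : L, u = mode κ r x}
  lie_mem' {u v} hu hv := by
    change _ ∈ Submodule.span ℂ _
    induction hu using Submodule.span_induction with
    | zero => rw [zero_lie]; exact Submodule.zero_mem _
    | add a b _ _ ha hb => rw [add_lie]; exact Submodule.add_mem _ ha hb
    | smul c a _ ha => rw [smul_lie]; exact Submodule.smul_mem _ _ ha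
    | mem a ha =>
      obtain ⟨r, hr, x, rfl⟩ := ha
      induction hv using Submodule.span_induction with
      | zero => rw [lie_zero]; exact Submodule.zero_mem _
      | add a b _ _ ha hb => rw [lie_add]; exact Submodule.add_mem _ ha hb
      | smul c a _ ha => rw [lie_smul]; exact Submodule.smul_mem _ _ ha
      | mem b hb =>
        obtain ⟨s, hs, y, rfl⟩ := hb
        rw [lie_mode, if_neg (by omega), zero_smul, add_zero]
        exact Submodule.subset_span ⟨r + s, by omega, _, rfl⟩

/-- The element `x[r]`, `r < 0`, of `L[t⁻¹]t⁻¹`. -/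
def negMode (κ : InvForm L) (r : ℤ) (hr : r < 0) (x : L) : negPart κ :=
  ⟨mode κ r x, Submodule.subset_span ⟨r, hr, x, rfl⟩⟩

lemma affDeriv_mem (κ : InvForm L) {u : Aff κ} (hu : u ∈ negPart κ) :
    affDeriv κ u ∈ negPart κ := by
  change _ ∈ Submodule.span ℂ _
  induction hu using Submodule.span_induction with
  | zero => rw [map_zero]; exact Submodule.zero_mem _
  | add a b _ _ ha hb => rw [map_add]; exact Submodule.add_mem _ ha hb
  | smul c a _ ha => rw [map_smul]; exact Submodule.smul_mem _ _ ha
  | mem a ha =>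
    obtain ⟨r, hr, x, rfl⟩ := ha
    rw [affDeriv_mode]
    exact Submodule.smul_mem _ _ (Submodule.subset_span ⟨r - 1, by omega, _, rfl⟩)

/-- The associative algebra `U(L[t⁻¹]t⁻¹)`. -/
abbrev UNeg (κ : InvForm L) := UniversalEnvelopingAlgebra ℂ (negPart κ)

/-- The derivation `ad τ` of `U(L[t⁻¹]t⁻¹)`. -/
def adTau (κ : InvForm L) : AlgDer (UNeg κ) :=
  envDeriv ((affDeriv κ).restrict (p := (negPart κ).toSubmodule) (q := (negPart κ).toSubmodule)
    fun _ h => affDeriv_mem κ h) fun x y => Subtype.ext (affDeriv_lie κ x y)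

/-- The element `x[-1]` of `U(L[t⁻¹]t⁻¹)`. -/
def cur (κ : InvForm L) (x : L) : UNeg κ :=
  UniversalEnvelopingAlgebra.ι ℂ (negMode κ (-1) (by norm_num) x)

lemma adTau_mode (κ : InvForm L) (r : ℤ) (hr : r < 0) (x : L) :
    (adTau κ).toLin (UniversalEnvelopingAlgebra.ι ℂ (negMode κ r hr x)) =
      -(r : ℂ) • UniversalEnvelopingAlgebra.ι ℂ (negMode κ (r - 1) (by omega) x) := by
  rw [adTau, envDeriv_ι, ← map_smul]
  congr 1
  exact Subtype.ext (affDeriv_mode κ r x)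

/-- Linear maps on the quotient of an algebra by a left ideal. -/
def quotLift {A V : Type*} [Ring A] [Algebra ℂ A] [AddCommGroup V] [Module ℂ V]
    (J : Submodule A A) (f : A →ₗ[ℂ] V) (h : ∀ a ∈ J, f a = 0) : (A ⧸ J) →ₗ[ℂ] V :=
  ((J.restrictScalars ℂ).liftQ f h).comp
    (Submodule.Quotient.restrictScalarsEquiv ℂ J).symm.toLinearMap

lemma quotLift_mk {A V : Type*} [Ring A] [Algebra ℂ A] [AddCommGroup V] [Module ℂ V]
    (J : Submodule A A) (f : A →ₗ[ℂ] V) (h : ∀ a ∈ J, f a = 0) (a : A) :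
    quotLift J f h (Submodule.Quotient.mk a) = f a := rfl

/-- The left ideal of `U(L[t, t⁻¹] ⊕ ℂ 𝟏)` generated by `L[t]` and `𝟏 - 1`. -/
def vacIdeal (κ : InvForm L) :
    Submodule (UniversalEnvelopingAlgebra ℂ (Aff κ)) (UniversalEnvelopingAlgebra ℂ (Aff κ)) :=
  Submodule.span _ ({u | ∃ r : ℤ, 0 ≤ r ∧ ∃ x : L, u = UniversalEnvelopingAlgebra.ι ℂ (mode κ r x)} ∪
    {UniversalEnvelopingAlgebra.ι ℂ (central κ) - 1})

/-- The universal affine vertex algebra of `L` and `κ`: the module induced from the one-dimensional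
representation of `L[t] ⊕ ℂ 𝟏` on which `L[t]` acts by zero and `𝟏` acts as `1`, that is the
quotient of the enveloping algebra by the left ideal generated by the annihilator of the vacuum. -/
def VacMod (κ : InvForm L) := UniversalEnvelopingAlgebra ℂ (Aff κ) ⧸ vacIdeal κ

instance (κ : InvForm L) : AddCommGroup (VacMod κ) :=
  inferInstanceAs (AddCommGroup (UniversalEnvelopingAlgebra ℂ (Aff κ) ⧸ vacIdeal κ))
instance (κ : InvForm L) : Module (UniversalEnvelopingAlgebra ℂ (Aff κ)) (VacMod κ) :=
  inferInstanceAs (Module (UniversalEnvelopingAlgebra ℂ (Aff κ))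
    (UniversalEnvelopingAlgebra ℂ (Aff κ) ⧸ vacIdeal κ))
instance (κ : InvForm L) : Module ℂ (VacMod κ) :=
  inferInstanceAs (Module ℂ (UniversalEnvelopingAlgebra ℂ (Aff κ) ⧸ vacIdeal κ))
instance (κ : InvForm L) : IsScalarTower ℂ (UniversalEnvelopingAlgebra ℂ (Aff κ)) (VacMod κ) :=
  inferInstanceAs (IsScalarTower ℂ (UniversalEnvelopingAlgebra ℂ (Aff κ))
    (UniversalEnvelopingAlgebra ℂ (Aff κ) ⧸ vacIdeal κ))

/-- The map `u ↦ u|0⟩` from the enveloping algebra to the universal affine vertex algebra. -/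
def VacMod.mk (κ : InvForm L) :
    UniversalEnvelopingAlgebra ℂ (Aff κ) →ₗ[UniversalEnvelopingAlgebra ℂ (Aff κ)] VacMod κ :=
  (vacIdeal κ).mkQ

lemma VacMod.mk_eq_zero (κ : InvForm L) {u : UniversalEnvelopingAlgebra ℂ (Aff κ)}
    (hu : u ∈ vacIdeal κ) : VacMod.mk κ u = 0 :=
  (Submodule.Quotient.mk_eq_zero _).2 hu

/-- An element of `U(L[t⁻¹]t⁻¹)` regarded as an element of the universal affine vertex algebra. -/
def UNeg.toVac (κ : InvForm L) : UNeg κ →ₗ[ℂ] VacMod κ :=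
  ((VacMod.mk κ).restrictScalars ℂ).comp
    (UniversalEnvelopingAlgebra.lift ℂ
      ((UniversalEnvelopingAlgebra.ι ℂ).comp (negPart κ).incl)).toLinearMap

variable {L' : Type*} [LieRing L'] [LieAlgebra ℂ L']

/-- The linear map of affinizations induced by a linear map `f`: it sends `x[r]` to `f(x)[r]` and
`𝟏` to `𝟏`. -/
def affLin (κ : InvForm L) (κ' : InvForm L') (f : L →ₗ[ℂ] L') : Aff κ →ₗ[ℂ] Aff κ' where
  toFun x := ofProd κ'.cocycle
    (f.lTensor (AddMonoidAlgebra ℂ ℤ) ((ofProd κ.cocycle).symm x).1,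
      (TrivialLieModule.equiv ℂ (loopAlgebra ℂ ℤ L') ℂ).symm
        (TrivialLieModule.equiv ℂ (loopAlgebra ℂ ℤ L) ℂ ((ofProd κ.cocycle).symm x).2))
  map_add' x y := by
    simp only [of_symm_add, Prod.fst_add, Prod.snd_add, map_add, ← of_add, Prod.mk_add_mk]
  map_smul' c x := by
    simp only [of_symm_smul, Prod.smul_fst, Prod.smul_snd, map_smul, ← of_smul, Prod.smul_mk,
      RingHom.id_apply]

lemma affLin_mode (κ : InvForm L) (κ' : InvForm L') (f : L →ₗ[ℂ] L') (r : ℤ) (x : L) :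
    affLin κ κ' f (mode κ r x) = mode κ' r (f x) := rfl

lemma affLin_central (κ : InvForm L) (κ' : InvForm L') (f : L →ₗ[ℂ] L') :
    affLin κ κ' f (central κ) = central κ' := by
  change ofProd κ'.cocycle (f.lTensor (AddMonoidAlgebra ℂ ℤ) 0, _) = _
  rw [map_zero]
  rfl

/-- The homomorphism of affinizations induced by a homomorphism of Lie algebras with forms. -/
def affMap (κ : InvForm L) (κ' : InvForm L') (f : L →ₗ⁅ℂ⁆ L')
    (hf : ∀ x y, κ'.form (f x) (f y) = κ.form x y) : Aff κ →ₗ⁅ℂ⁆ Aff κ' where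
  __ := affLin κ κ' (f : L →ₗ[ℂ] L')
  map_lie' := by
    intro x y
    change affLin κ κ' _ ⁅x, y⁆ = ⁅affLin κ κ' _ x, affLin κ κ' _ y⁆
    induction x using aff_induction κ with
    | hc => rw [central_lie, affLin_central, central_lie, map_zero]
    | hadd u v hu hv => rw [add_lie, map_add, hu, hv, map_add, add_lie]
    | hsmul c u hu => rw [smul_lie, map_smul, hu, map_smul, smul_lie]
    | hmode r x =>
      induction y using aff_induction κ with
      | hc => rw [affLin_central, ← lie_skew, central_lie, ← lie_skew, central_lie, neg_zero,
          neg_zero, map_zero]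
      | hadd u v hu hv => rw [lie_add, map_add, hu, hv, map_add, lie_add]
      | hsmul c u hu => rw [lie_smul, map_smul, hu, map_smul, lie_smul]
      | hmode s y =>
        rw [lie_mode, map_add, map_smul, affLin_mode, affLin_mode, affLin_mode, affLin_central,
          lie_mode]
        simp only [LieHom.coe_toLinearMap, hf, LieHom.map_lie]

lemma affMap_mode (κ : InvForm L) (κ' : InvForm L') (f : L →ₗ⁅ℂ⁆ L')
    (hf : ∀ x y, κ'.form (f x) (f y) = κ.form x y) (r : ℤ) (x : L) :
    affMap κ κ' f hf (mode κ r x) = mode κ' r (f x) := rfl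

lemma affMap_central (κ : InvForm L) (κ' : InvForm L') (f : L →ₗ⁅ℂ⁆ L')
    (hf : ∀ x y, κ'.form (f x) (f y) = κ.form x y) :
    affMap κ κ' f hf (central κ) = central κ' := affLin_central κ κ' _

/-- The homomorphism of enveloping algebras induced by a homomorphism of Lie algebras with forms. -/
def envMap (κ : InvForm L) (κ' : InvForm L') (f : L →ₗ⁅ℂ⁆ L')
    (hf : ∀ x y, κ'.form (f x) (f y) = κ.form x y) :
    UniversalEnvelopingAlgebra ℂ (Aff κ) →ₐ[ℂ] UniversalEnvelopingAlgebra ℂ (Aff κ') :=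
  UniversalEnvelopingAlgebra.lift ℂ ((UniversalEnvelopingAlgebra.ι ℂ).comp (affMap κ κ' f hf))

/-- The homomorphism of universal affine vertex algebras induced by a homomorphism `f` of Lie
algebras with forms: it maps `x[r] y[s] ⋯ |0⟩` to `f(x)[r] f(y)[s] ⋯ |0⟩`. -/
def vacMap (κ : InvForm L) (κ' : InvForm L') (f : L →ₗ⁅ℂ⁆ L')
    (hf : ∀ x y, κ'.form (f x) (f y) = κ.form x y) : VacMod κ →ₗ[ℂ] VacMod κ' :=
  quotLift (vacIdeal κ)
    (((VacMod.mk κ').restrictScalars ℂ).comp (envMap κ κ' f hf).toLinearMap) <| by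
      intro a ha
      refine VacMod.mk_eq_zero κ' ?_
      rw [AlgHom.toLinearMap_apply]
      induction ha using Submodule.span_induction with
      | zero => rw [map_zero]; exact Submodule.zero_mem _
      | add u v _ _ hu hv => rw [map_add]; exact Submodule.add_mem _ hu hv
      | smul c u _ hu => rw [smul_eq_mul, map_mul]; exact Submodule.smul_mem _ _ hu
      | mem u hu =>
        refine Submodule.subset_span ?_
        obtain ⟨r, hr, x, rfl⟩ | rfl := hu
        · refine Or.inl ⟨r, hr, f x, ?_⟩
          rw [envMap, UniversalEnvelopingAlgebra.lift_ι_apply, LieHom.comp_apply, affMap_mode]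
        · refine Or.inr ?_
          rw [map_sub, map_one, envMap, UniversalEnvelopingAlgebra.lift_ι_apply, LieHom.comp_apply,
            affMap_central]
          rfl

end General

section DiffPoly

variable {A : Type*} [Ring A] [Algebra ℂ A]

open Polynomial

/-- The algebra `A ⊗ ℂ[τ]`, whose elements are the polynomials `∑ aₙ τⁿ` with coefficients written
on the left, with the multiplication determined by `τ a - a τ = δ(a)`. -/
def DiffPoly (_δ : AlgDer A) := A[X]

namespace DiffPoly

variable (δ : AlgDer A)

instance : AddCommGroup (DiffPoly δ) := inferInstanceAs (AddCommGroup A[X])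
instance : Module ℂ (DiffPoly δ) := inferInstanceAs (Module ℂ A[X])

/-- Left multiplication by `a ∈ A`. -/
def lmul : A →ₗ[ℂ] Module.End ℂ A[X] where
  toFun a :=
    { toFun p := Polynomial.C a * p
      map_add' p q := mul_add _ _ _
      map_smul' c p := by simp }
  map_add' a b := by ext; simp [add_mul]
  map_smul' c a := by ext; simp

/-- Left multiplication by `τ`, sending `a τⁿ` to `a τⁿ⁺¹ + δ(a) τⁿ`. -/
def lmulTau : Module.End ℂ A[X] :=
  Polynomial.lsum fun n => (monomial (n + 1)).restrictScalars ℂ +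
    ((monomial n).restrictScalars ℂ).comp δ.toLin

lemma lmulTau_monomial (n : ℕ) (a : A) :
    lmulTau δ (monomial n a) = monomial (n + 1) a + monomial n (δ.toLin a) := by
  rw [lmulTau, Polynomial.lsum_apply, Polynomial.sum_monomial_index _ _ (by simp)]
  simp

lemma lmul_monomial (a : A) (n : ℕ) (b : A) : lmul a (monomial n b) = monomial n (a * b) := by
  simp [lmul, C_mul_monomial]

lemma lmulTau_mul_lmul (a : A) : lmulTau δ * lmul a = lmul a * lmulTau δ + lmul (δ.toLin a) := by
  refine LinearMap.ext fun p => ?_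
  induction p using Polynomial.induction_on' with
  | add p q hp hq => rw [map_add, map_add, hp, hq]
  | monomial n b =>
    simp only [Module.End.mul_apply, LinearMap.add_apply, lmul_monomial, lmulTau_monomial, map_add,
      δ.leibniz]
    abel

/-- Left multiplication by an element of `A ⊗ ℂ[τ]`. -/
def lmulPoly : A[X] →ₗ[ℂ] Module.End ℂ A[X] :=
  Polynomial.lsum fun n => (LinearMap.mulRight ℂ (lmulTau δ ^ n)).comp lmul

lemma lmulPoly_monomial (n : ℕ) (a : A) :
    lmulPoly δ (monomial n a) = lmul a * lmulTau δ ^ n := by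
  rw [lmulPoly, Polynomial.lsum_apply, Polynomial.sum_monomial_index _ _ (by simp)]
  simp

lemma lmulPoly_lmul (a : A) (p : A[X]) : lmulPoly δ (lmul a p) = lmul a * lmulPoly δ p := by
  induction p using Polynomial.induction_on' with
  | add p q hp hq => rw [map_add, map_add, hp, hq, map_add, mul_add]
  | monomial n b =>
    have : (lmul (a * b) : Module.End ℂ A[X]) = lmul a * lmul b := by
      refine LinearMap.ext fun q => ?_
      simp [lmul, mul_assoc]
    rw [lmul_monomial, lmulPoly_monomial, lmulPoly_monomial, this, mul_assoc]

lemma lmulPoly_lmulTau (p : A[X]) : lmulPoly δ (lmulTau δ p) = lmulTau δ * lmulPoly δ p := by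
  induction p using Polynomial.induction_on' with
  | add p q hp hq => rw [map_add, map_add, hp, hq, map_add, mul_add]
  | monomial n b =>
    rw [lmulTau_monomial, map_add, lmulPoly_monomial, lmulPoly_monomial, lmulPoly_monomial,
      ← mul_assoc, lmulTau_mul_lmul, add_mul, pow_succ', mul_assoc]

lemma lmulPoly_lmulPoly (p q : A[X]) :
    lmulPoly δ (lmulPoly δ p q) = lmulPoly δ p * lmulPoly δ q := by
  induction p using Polynomial.induction_on' with
  | add p p' hp hp' =>
    rw [map_add, LinearMap.add_apply, map_add, hp, hp', add_mul]
  | monomial n a =>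
    have h : ∀ n : ℕ, lmulPoly δ ((lmulTau δ ^ n) q) = lmulTau δ ^ n * lmulPoly δ q := by
      intro n
      induction n with
      | zero => simp
      | succ n ih => rw [pow_succ', Module.End.mul_apply, lmulPoly_lmulTau, ih, mul_assoc]
    rw [lmulPoly_monomial, Module.End.mul_apply, lmulPoly_lmul, h, mul_assoc]

lemma δ_one : δ.toLin 1 = 0 := by
  have := δ.leibniz 1 1
  simpa using this

lemma lmulPoly_one_right (p : A[X]) : lmulPoly δ p 1 = p := by
  induction p using Polynomial.induction_on' with
  | add p p' hp hp' => rw [map_add, LinearMap.add_apply, hp, hp']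
  | monomial n a =>
    have h : ∀ n : ℕ, (lmulTau δ ^ n) (1 : A[X]) = monomial n 1 := by
      intro n
      induction n with
      | zero => simp
      | succ n ih =>
        rw [pow_succ', Module.End.mul_apply, ih, lmulTau_monomial, δ_one, map_zero, add_zero]
    rw [lmulPoly_monomial, Module.End.mul_apply, h, lmul_monomial, mul_one]

instance : One (DiffPoly δ) := ⟨(1 : A[X])⟩
instance : Mul (DiffPoly δ) := ⟨fun p q => lmulPoly δ p q⟩

lemma lmulPoly_one : lmulPoly δ (1 : A[X]) = 1 := by
  rw [← monomial_zero_one, lmulPoly_monomial]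
  refine LinearMap.ext fun q => ?_
  simp [lmul]

instance : Ring (DiffPoly δ) where
  __ := (inferInstance : AddCommGroup (DiffPoly δ))
  mul_assoc p q r := congrArg (fun f => f r) (lmulPoly_lmulPoly δ p q)
  one_mul p := congrArg (fun f => f p) (lmulPoly_one δ)
  mul_one p := lmulPoly_one_right δ p
  left_distrib p q r := (lmulPoly δ p).map_add q r
  right_distrib p q r := congrArg (fun f => f r) ((lmulPoly δ).map_add p q)
  zero_mul p := congrArg (fun f => f p) (lmulPoly δ).map_zero
  mul_zero p := (lmulPoly δ p).map_zero

instance : Algebra ℂ (DiffPoly δ) :=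
  Algebra.ofModule
    (fun c p q => congrArg (fun f => f q) ((lmulPoly δ).map_smul c p))
    (fun c p q => (lmulPoly δ p).map_smul c q)

/-- The element `a ∈ A` of `A ⊗ ℂ[τ]`. -/
def const (a : A) : DiffPoly δ := (Polynomial.C a : A[X])

/-- The element `τ` of `A ⊗ ℂ[τ]`. -/
def tau : DiffPoly δ := (Polynomial.X : A[X])

variable {δ} in
/-- The coefficient `a_n` of `∑ a_n τ^n`. -/
def coeff (p : DiffPoly δ) (n : ℕ) : A := Polynomial.coeff p n

variable {δ} in
/-- The image of `∑ a_n τ^n` in `V ⊗ ℂ[τ]` under a linear map `A → V`. -/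
def mapCoeff {V : Type*} [AddCommGroup V] [Module ℂ V] (f : A →ₗ[ℂ] V) :
    DiffPoly δ →ₗ[ℂ] V ⊗[ℂ] ℂ[X] :=
  Polynomial.lsum (R := ℂ) (A := A) fun n => ((TensorProduct.mk ℂ V ℂ[X]).flip (X ^ n)).comp f

lemma const_mul_const (a b : A) : const δ a * const δ b = const δ (a * b) := by
  change lmulPoly δ (Polynomial.C a) (Polynomial.C b) = Polynomial.C (a * b)
  rw [← monomial_zero_left, ← monomial_zero_left, lmulPoly_monomial, pow_zero, mul_one,
    lmul_monomial, monomial_zero_left]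

lemma tau_mul_const (a : A) :
    tau δ * const δ a = const δ a * tau δ + const δ (δ.toLin a) := by
  change lmulPoly δ Polynomial.X (Polynomial.C a) =
    lmulPoly δ (Polynomial.C a) Polynomial.X + Polynomial.C (δ.toLin a)
  rw [← monomial_one_one_eq_X, ← monomial_zero_left, ← monomial_zero_left, lmulPoly_monomial,
    lmulPoly_monomial, pow_zero, mul_one, lmul_monomial, pow_one, mul_one, Module.End.mul_apply,
    lmulTau_monomial, map_add, lmul_monomial, lmul_monomial, one_mul, one_mul]

end DiffPoly
end DiffPoly

section Super

/-- The defining relations of the enveloping algebra of the Lie superalgebra `L ⊕ M` whose even part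
is `L` and whose odd part is the `L`-module `M` with the zero bracket `M × M → L`. -/
inductive SuperRel (L M : Type*) [LieRing L] [LieAlgebra ℂ L] [AddCommGroup M] [Module ℂ M]
    [LieRingModule L M] : TensorAlgebra ℂ (L × M) → TensorAlgebra ℂ (L × M) → Prop
  | even_even (x y : L) : SuperRel L M
      (TensorAlgebra.ι ℂ (x, 0) * TensorAlgebra.ι ℂ (y, 0))
      (TensorAlgebra.ι ℂ (⁅x, y⁆, 0) + TensorAlgebra.ι ℂ (y, 0) * TensorAlgebra.ι ℂ (x, 0))
  | even_odd (x : L) (m : M) : SuperRel L M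
      (TensorAlgebra.ι ℂ (x, 0) * TensorAlgebra.ι ℂ (0, m))
      (TensorAlgebra.ι ℂ (0, ⁅x, m⁆) + TensorAlgebra.ι ℂ (0, m) * TensorAlgebra.ι ℂ (x, 0))
  | odd_odd (m n : M) : SuperRel L M
      (TensorAlgebra.ι ℂ (0, m) * TensorAlgebra.ι ℂ (0, n))
      (-(TensorAlgebra.ι ℂ (0, n) * TensorAlgebra.ι ℂ (0, m)))

/-- The enveloping algebra of the Lie superalgebra `L ⊕ M` with supercommutative odd part `M`. -/
def SuperEnv (L M : Type*) [LieRing L] [LieAlgebra ℂ L] [AddCommGroup M] [Module ℂ M]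
    [LieRingModule L M] := RingQuot (SuperRel L M)

namespace SuperEnv

variable {L M : Type*} [LieRing L] [LieAlgebra ℂ L] [AddCommGroup M] [Module ℂ M]
  [LieRingModule L M]

instance : Ring (SuperEnv L M) := inferInstanceAs (Ring (RingQuot (SuperRel L M)))
instance : Algebra ℂ (SuperEnv L M) := inferInstanceAs (Algebra ℂ (RingQuot (SuperRel L M)))

variable (L M) in
/-- The quotient map from the tensor algebra. -/
def mk : TensorAlgebra ℂ (L × M) →ₐ[ℂ] SuperEnv L M := RingQuot.mkAlgHom ℂ (SuperRel L M)

lemma mk_rel {a b : TensorAlgebra ℂ (L × M)} (h : SuperRel L M a b) : mk L M a = mk L M b :=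
  RingQuot.mkAlgHom_rel ℂ h

/-- The universal property of the enveloping algebra. -/
def lift {A : Type*} [Ring A] [Algebra ℂ A] (f : TensorAlgebra ℂ (L × M) →ₐ[ℂ] A)
    (hf : ∀ ⦃a b⦄, SuperRel L M a b → f a = f b) : SuperEnv L M →ₐ[ℂ] A :=
  RingQuot.liftAlgHom ℂ ⟨f, hf⟩

lemma lift_mk {A : Type*} [Ring A] [Algebra ℂ A] (f : TensorAlgebra ℂ (L × M) →ₐ[ℂ] A)
    (hf : ∀ ⦃a b⦄, SuperRel L M a b → f a = f b) (a : TensorAlgebra ℂ (L × M)) :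
    lift f hf (mk L M a) = f a :=
  RingQuot.liftAlgHom_mkAlgHom_apply ..

lemma mk_surjective : Function.Surjective (mk L M) := RingQuot.mkAlgHom_surjective ℂ (SuperRel L M)

variable (L M) in
/-- The even generators. -/
def even : L →ₗ[ℂ] SuperEnv L M :=
  ((mk L M).toLinearMap.comp (TensorAlgebra.ι ℂ)).comp
    (LinearMap.inl ℂ L M)

variable (L M) in
/-- The odd generators. -/
def odd : M →ₗ[ℂ] SuperEnv L M :=
  ((mk L M).toLinearMap.comp (TensorAlgebra.ι ℂ)).comp
    (LinearMap.inr ℂ L M)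

lemma even_mul_even (x y : L) :
    even L M x * even L M y = even L M ⁅x, y⁆ + even L M y * even L M x := by
  have := mk_rel (SuperRel.even_even (M := M) x y)
  rw [map_mul, map_add, map_mul] at this
  exact this

lemma even_mul_odd (x : L) (m : M) :
    even L M x * odd L M m = odd L M ⁅x, m⁆ + odd L M m * even L M x := by
  have := mk_rel (SuperRel.even_odd x m)
  rw [map_mul, map_add, map_mul] at this
  exact this

lemma odd_mul_odd (m n : M) : odd L M m * odd L M n = -(odd L M n * odd L M m) := by
  have := mk_rel (SuperRel.odd_odd (L := L) m n)
  rw [map_mul, map_neg, map_mul] at this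
  exact this

variable (M) in
/-- The homomorphism `U(L) → U(L ⊕ M)`. -/
def ofEven : UniversalEnvelopingAlgebra ℂ L →ₐ[ℂ] SuperEnv L M :=
  UniversalEnvelopingAlgebra.lift ℂ
    { even L M with
      map_lie' := by
        intro x y
        change even L M ⁅x, y⁆ = even L M x * even L M y - even L M y * even L M x
        rw [even_mul_even, add_sub_cancel_right] }

lemma ofEven_ι (x : L) : ofEven M (UniversalEnvelopingAlgebra.ι ℂ x) = even L M x :=
  UniversalEnvelopingAlgebra.lift_ι_apply _ _ _

/-- The derivation of the enveloping algebra of `L ⊕ M` which extends an even derivation of the Lie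
superalgebra `L ⊕ M`. -/
def deriv (d : L →ₗ[ℂ] L) (hd : ∀ x y, d ⁅x, y⁆ = ⁅d x, y⁆ + ⁅x, d y⁆) (e : M →ₗ[ℂ] M)
    (he : ∀ (x : L) (m : M), e ⁅x, m⁆ = ⁅d x, m⁆ + ⁅x, e m⁆) : AlgDer (SuperEnv L M) :=
  let f : L × M →ₗ[ℂ] DualNumber (SuperEnv L M) :=
    { toFun u := TrivSqZeroExt.inl (even L M u.1 + odd L M u.2) +
        TrivSqZeroExt.inr (even L M (d u.1) + odd L M (e u.2))
      map_add' u v := by ext <;> simp <;> abel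
      map_smul' c u := by ext <;> simp }
  let F : SuperEnv L M →ₐ[ℂ] DualNumber (SuperEnv L M) :=
    lift (TensorAlgebra.lift ℂ f) <| by
      intro a b h
      induction h with
      | even_even x y =>
        ext
        · simp [f, even_mul_even x y]
        · simp [f, hd, even_mul_even x (d y), even_mul_even (d x) y]
          abel
      | even_odd x m =>
        ext
        · simp [f, even_mul_odd x m]
        · simp [f, he, even_mul_odd x (e m), even_mul_odd (d x) m]
          abel
      | odd_odd m n =>
        ext
        · simp [f, odd_mul_odd m n]
        · simp [f, odd_mul_odd m (e n), odd_mul_odd (e m) n]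
  AlgDer.ofDual F fun a => by
    obtain ⟨a, rfl⟩ := mk_surjective a
    have : ((TrivSqZeroExt.fstHom ℂ _ _).comp F).comp (mk L M) = mk L M := by
      refine TensorAlgebra.hom_ext (LinearMap.ext fun u => ?_)
      simp [F, lift_mk, f, even, odd, ← map_add]
    exact congrArg (fun g => g a) this

lemma deriv_even (d : L →ₗ[ℂ] L) (hd : ∀ x y, d ⁅x, y⁆ = ⁅d x, y⁆ + ⁅x, d y⁆) (e : M →ₗ[ℂ] M)
    (he : ∀ (x : L) (m : M), e ⁅x, m⁆ = ⁅d x, m⁆ + ⁅x, e m⁆) (x : L) :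
    (deriv d hd e he).toLin (even L M x) = even L M (d x) := by
  change TrivSqZeroExt.snd (lift _ _ (mk L M (TensorAlgebra.ι ℂ (x, 0)))) = _
  rw [lift_mk]
  simp

lemma deriv_odd (d : L →ₗ[ℂ] L) (hd : ∀ x y, d ⁅x, y⁆ = ⁅d x, y⁆ + ⁅x, d y⁆) (e : M →ₗ[ℂ] M)
    (he : ∀ (x : L) (m : M), e ⁅x, m⁆ = ⁅d x, m⁆ + ⁅x, e m⁆) (m : M) :
    (deriv d hd e he).toLin (odd L M m) = odd L M (e m) := by
  change TrivSqZeroExt.snd (lift _ _ (mk L M (TensorAlgebra.ι ℂ (0, m)))) = _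
  rw [lift_mk]
  simp

end SuperEnv

end Super

section Principal

variable (N : ℕ) (k : ℂ)

/-- The Lie algebra `𝔟` of lower triangular matrices. -/
def lowerTri : LieSubalgebra ℂ (Matrix (Fin N) (Fin N) ℂ) where
  carrier := {A | ∀ i j, i < j → A i j = 0}
  add_mem' {A B} hA hB i j h := by simp [hA i j h, hB i j h]
  zero_mem' i j _ := rfl
  smul_mem' c A hA i j h := by simp [hA i j h]
  lie_mem' {A B} hA hB i j h := by
    have key : ∀ {A B : Matrix (Fin N) (Fin N) ℂ}, (∀ i j, i < j → A i j = 0) →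
        (∀ i j, i < j → B i j = 0) → (A * B) i j = 0 := by
      intro A B hA hB
      rw [Matrix.mul_apply]
      refine Finset.sum_eq_zero fun a _ => ?_
      rcases lt_or_ge i a with ha | ha
      · rw [hA i a ha, zero_mul]
      · rw [hB a j (ha.trans_lt h), mul_zero]
    rw [LieRing.of_associative_ring_bracket, Matrix.sub_apply, key hA hB, key hB hA, sub_zero]

variable {N} in
lemma lowerTri_mul_diag (A B : lowerTri N) (i : Fin N) :
    ((A : Matrix (Fin N) (Fin N) ℂ) * (B : Matrix (Fin N) (Fin N) ℂ)) i i =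
      (A : Matrix (Fin N) (Fin N) ℂ) i i * (B : Matrix (Fin N) (Fin N) ℂ) i i := by
  rw [Matrix.mul_apply]
  refine Finset.sum_eq_single i (fun a _ ha => ?_) (by simp)
  rcases lt_or_gt_of_ne ha with h | h
  · rw [B.2 a i h, mul_zero]
  · rw [A.2 i a h, zero_mul]

variable {N} in
lemma lowerTri_lie_diag (A B : lowerTri N) (i : Fin N) :
    (⁅A, B⁆ : lowerTri N).1 i i = 0 := by
  rw [LieSubalgebra.coe_bracket, LieRing.of_associative_ring_bracket, Matrix.sub_apply,
    lowerTri_mul_diag, lowerTri_mul_diag, mul_comm, sub_self]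

/-- The ideal `𝔪` of `𝔟` of strictly lower triangular matrices. -/
def strictTri : LieIdeal ℂ (lowerTri N) where
  carrier := {A | ∀ i, A.1 i i = 0}
  add_mem' {A B} hA hB i := by simp [hA i, hB i]
  zero_mem' i := rfl
  smul_mem' c A hA i := by simp [hA i]
  lie_mem {A B} _ i := lowerTri_lie_diag A B i

/-- The Lie algebra `𝔩` of diagonal matrices. -/
def diagMat : LieSubalgebra ℂ (Matrix (Fin N) (Fin N) ℂ) where
  carrier := {A | ∀ i j, i ≠ j → A i j = 0}
  add_mem' {A B} hA hB i j h := by simp [hA i j h, hB i j h]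
  zero_mem' i j _ := rfl
  smul_mem' c A hA i j h := by simp [hA i j h]
  lie_mem' {A B} hA hB i j h := by
    have key : ∀ {A B : Matrix (Fin N) (Fin N) ℂ}, (∀ i j, i ≠ j → A i j = 0) →
        (∀ i j, i ≠ j → B i j = 0) → (A * B) i j = 0 := by
      intro A B hA hB
      rw [Matrix.mul_apply]
      refine Finset.sum_eq_zero fun a _ => ?_
      rcases eq_or_ne i a with rfl | ha
      · rw [hB i j h, mul_zero]
      · rw [hA i a ha, zero_mul]
    rw [LieRing.of_associative_ring_bracket, Matrix.sub_apply, key hA hB, key hB hA, sub_zero]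

/-- The inclusion `𝔩 → 𝔟`. -/
def diagIncl : diagMat N →ₗ⁅ℂ⁆ lowerTri N where
  toFun A := ⟨A.1, fun i j h => A.2 i j h.ne⟩
  map_add' _ _ := rfl
  map_smul' _ _ := rfl
  map_lie' {_ _} := rfl

/-- The projection `𝔟 → 𝔩`. -/
def diagProj : lowerTri N →ₗ⁅ℂ⁆ diagMat N where
  toFun A := ⟨Matrix.diagonal fun i => A.1 i i, fun i j h => Matrix.diagonal_apply_ne _ h⟩
  map_add' A B := by
    refine Subtype.ext ?_
    simp [← Matrix.diagonal_add]
  map_smul' c A := by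
    refine Subtype.ext ?_
    simp [← Matrix.diagonal_smul]
  map_lie' {A B} := by
    refine Subtype.ext ?_
    have h : (fun i => (⁅A, B⁆ : lowerTri N).1 i i) = fun _ => 0 :=
      funext fun i => lowerTri_lie_diag A B i
    change Matrix.diagonal (fun i => (⁅A, B⁆ : lowerTri N).1 i i) =
      Matrix.diagonal (fun i => A.1 i i) * Matrix.diagonal (fun i => B.1 i i) -
      Matrix.diagonal (fun i => B.1 i i) * Matrix.diagonal (fun i => A.1 i i)
    rw [h, Matrix.diagonal_mul_diagonal, Matrix.diagonal_mul_diagonal, Matrix.diagonal_zero]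
    simp only [mul_comm, sub_self]

/-- The form `κ_𝔟` on `𝔟`, for which `κ_𝔟(e_{ii'}, e_{jj'})` is
`δ_{ii'} δ_{jj'} (k + N) (δ_{ij} - 1/N)`. -/
def formB : InvForm (lowerTri N) where
  form := LinearMap.mk₂ ℂ
    (fun A B => (k + N) * (∑ i, A.1 i i * B.1 i i - 1 / N * ((∑ i, A.1 i i) * ∑ i, B.1 i i)))
    (by intro A A' B; simp [add_mul, Finset.sum_add_distrib]; ring)
    (by intro c A B; simp [mul_assoc, ← Finset.mul_sum]; ring)
    (by intro A B B'; simp [mul_add, Finset.sum_add_distrib]; ring)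
    (by intro c A B; simp [mul_left_comm _ c, ← Finset.mul_sum]; ring)
  symm _ _ := by
    simp only [LinearMap.mk₂_apply, mul_comm]
  inv _ _ _ := by
    simp only [LinearMap.mk₂_apply, lowerTri_lie_diag, zero_mul, mul_zero, Finset.sum_const_zero]

/-- The restriction of the form `κ_𝔟` to `𝔩`. -/
def formL : InvForm (diagMat N) where
  form := (formB N k).form.compl₁₂ (diagIncl N : diagMat N →ₗ[ℂ] lowerTri N)
    (diagIncl N : diagMat N →ₗ[ℂ] lowerTri N)
  symm A B := (formB N k).symm _ _
  inv A B C := (formB N k).inv (diagIncl N A) (diagIncl N B) (diagIncl N C)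

lemma formL_diagProj (A B : lowerTri N) :
    (formL N k).form (diagProj N A) (diagProj N B) = (formB N k).form A B := by
  simp [formL, formB, diagIncl, diagProj]

variable {N}

/-- The matrix unit `e_{ij} ∈ 𝔟` for `i ≥ j`, and `0` otherwise. -/
def eB (i j : Fin N) : lowerTri N :=
  if h : j ≤ i then ⟨Matrix.single i j 1, fun a b hab => by
    rw [Matrix.single_apply, if_neg]
    rintro ⟨rfl, rfl⟩
    exact absurd h hab.not_ge⟩ else 0

/-- The matrix unit `e_{ij} ∈ 𝔪` for `i > j`, and `0` otherwise. -/
def eM (i j : Fin N) : strictTri N :=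
  if h : j < i then ⟨eB i j, fun a => by
    rw [eB, dif_pos h.le]
    change Matrix.single i j 1 a a = 0
    rw [Matrix.single_apply, if_neg]
    rintro ⟨rfl, rfl⟩
    exact absurd h (lt_irrefl _)⟩ else 0

/-- The matrix unit `e_{ii} ∈ 𝔩`. -/
def eL (i : Fin N) : diagMat N :=
  ⟨Matrix.single i i 1, fun a b hab => by
    rw [Matrix.single_apply, if_neg]
    rintro ⟨rfl, rfl⟩
    exact hab rfl⟩

variable (N)

/-- The module `𝔪[t, t⁻¹]`. -/
abbrev OddLoop := AddMonoidAlgebra ℂ ℤ ⊗[ℂ] strictTri N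

instance : LieRingModule (Aff (formB N k)) (OddLoop N) :=
  LieRingModule.compLieHom (OddLoop N) (affProj (formB N k))

variable {N} in
lemma lie_oddLoop (x : Aff (formB N k)) (m : OddLoop N) :
    ⁅x, m⁆ = ⁅affProj (formB N k) x, m⁆ := rfl

/-- The enveloping algebra of the Lie superalgebra `𝔞̂ = 𝔟̂ ⊕ 𝔪[t, t⁻¹]`. -/
abbrev UA := SuperEnv (Aff (formB N k)) (OddLoop N)

variable {N}

/-- The even element `x[r] = x t^r`, for `x ∈ 𝔟`, of `U(𝔞̂)`. -/
def evenMode (r : ℤ) (x : lowerTri N) : UA N k :=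
  SuperEnv.even (Aff (formB N k)) (OddLoop N) (mode (formB N k) r x)

/-- The odd element `y t^r`, for `y ∈ 𝔪`, of `U(𝔞̂)`. -/
def oddMode (r : ℤ) (y : strictTri N) : UA N k :=
  SuperEnv.odd (Aff (formB N k)) (OddLoop N) (AddMonoidAlgebra.single r 1 ⊗ₜ y)

variable (N)

/-- The left ideal of `U(𝔞̂)` generated by `𝔟[t]`, `𝔪[t]` and `𝟏 - 1`. -/
def superVacIdeal : Submodule (UA N k) (UA N k) :=
  Submodule.span _ ({u | ∃ r : ℤ, 0 ≤ r ∧ ∃ x : lowerTri N, u = evenMode k r x} ∪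
    {u | ∃ r : ℤ, 0 ≤ r ∧ ∃ y : strictTri N, u = oddMode k r y} ∪
    {SuperEnv.even (Aff (formB N k)) (OddLoop N) (central (formB N k)) - 1})

/-- The induced `𝔞̂`-module `V^k(𝔞)`. -/
def VA := UA N k ⧸ superVacIdeal N k

instance : AddCommGroup (VA N k) := inferInstanceAs (AddCommGroup (UA N k ⧸ superVacIdeal N k))
instance : Module (UA N k) (VA N k) :=
  inferInstanceAs (Module (UA N k) (UA N k ⧸ superVacIdeal N k))
instance : Module ℂ (VA N k) := inferInstanceAs (Module ℂ (UA N k ⧸ superVacIdeal N k))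
instance : IsScalarTower ℂ (UA N k) (VA N k) :=
  inferInstanceAs (IsScalarTower ℂ (UA N k) (UA N k ⧸ superVacIdeal N k))

/-- The map `U(𝔞̂) → V^k(𝔞)`, `u ↦ u|0⟩`. -/
def VA.mk : UA N k →ₗ[UA N k] VA N k := (superVacIdeal N k).mkQ

lemma VA.mk_eq_zero {u : UA N k} (hu : u ∈ superVacIdeal N k) : VA.mk N k u = 0 :=
  (Submodule.Quotient.mk_eq_zero _).2 hu

/-- The vacuum vector of `V^k(𝔞)`. -/
def vacA : VA N k := VA.mk N k 1

/-- The embedding `V^k(𝔟) → V^k(𝔞)`. -/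
def inclA : VacMod (formB N k) →ₗ[ℂ] VA N k :=
  quotLift (vacIdeal (formB N k)) (((VA.mk N k).restrictScalars ℂ).comp
    (SuperEnv.ofEven (L := Aff (formB N k)) (OddLoop N)).toLinearMap) <| by
      intro a ha
      refine VA.mk_eq_zero N k ?_
      rw [AlgHom.toLinearMap_apply]
      induction ha using Submodule.span_induction with
      | zero => rw [map_zero]; exact Submodule.zero_mem _
      | add u v _ _ hu hv => rw [map_add]; exact Submodule.add_mem _ hu hv
      | smul c u _ hu => rw [smul_eq_mul, map_mul]; exact Submodule.smul_mem _ _ hu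
      | mem u hu =>
        refine Submodule.subset_span ?_
        obtain ⟨r, hr, x, rfl⟩ | rfl := hu
        · exact Or.inl (Or.inl ⟨r, hr, x, SuperEnv.ofEven_ι _⟩)
        · refine Or.inr ?_
          rw [map_sub, map_one, SuperEnv.ofEven_ι]
          rfl

/-- The derivation of `U(𝔞̂)` induced by `-d/dt`. -/
def derivUA : AlgDer (UA N k) :=
  SuperEnv.deriv (affDeriv (formB N k)) (affDeriv_lie (formB N k)) (loopDeriv (strictTri N))
    fun x m => by
      rw [lie_oddLoop, lie_oddLoop, lie_oddLoop]
      exact loopDeriv_lie (affProj (formB N k) x) m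

variable {N} in
lemma derivUA_evenMode (r : ℤ) (x : lowerTri N) :
    (derivUA N k).toLin (evenMode k r x) = -(r : ℂ) • evenMode k (r - 1) x := by
  rw [derivUA, evenMode, SuperEnv.deriv_even, affDeriv_mode, map_smul, evenMode]

variable {N} in
lemma derivUA_oddMode (r : ℤ) (y : strictTri N) :
    (derivUA N k).toLin (oddMode k r y) = -(r : ℂ) • oddMode k (r - 1) y := by
  rw [derivUA, oddMode, SuperEnv.deriv_odd, loopDeriv, LinearMap.rTensor_tmul, negDeriv_single,
    oddMode, ← map_smul, TensorProduct.smul_tmul', AddMonoidAlgebra.smul_single, smul_eq_mul]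

/-- The translation operator `D` of the vertex algebra `V^k(𝔞)`: it kills the vacuum and satisfies
`[D, x[r]] = -r x[r-1]` on even and odd modes. -/
def transl : VA N k →ₗ[ℂ] VA N k :=
  quotLift (superVacIdeal N k)
    (((VA.mk N k).restrictScalars ℂ).comp (derivUA N k).toLin) <| by
      intro a ha
      refine VA.mk_eq_zero N k ?_
      induction ha using Submodule.span_induction with
      | zero => rw [map_zero]; exact Submodule.zero_mem _
      | add u v _ _ hu hv => rw [map_add]; exact Submodule.add_mem _ hu hv
      | smul c u hu' hu =>
        rw [smul_eq_mul, (derivUA N k).leibniz]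
        exact Submodule.add_mem _ (Submodule.smul_mem _ _ hu') (Submodule.smul_mem _ _ hu)
      | mem u hu =>
        obtain (⟨r, hr, x, rfl⟩ | ⟨r, hr, y, rfl⟩) | rfl := hu
        · rw [derivUA_evenMode]
          rcases hr.eq_or_lt with rfl | h
          · rw [Int.cast_zero, neg_zero, zero_smul]; exact Submodule.zero_mem _
          · exact Submodule.smul_of_tower_mem _ _
              (Submodule.subset_span (Or.inl (Or.inl ⟨r - 1, by omega, x, rfl⟩)))
        · rw [derivUA_oddMode]
          rcases hr.eq_or_lt with rfl | h
          · rw [Int.cast_zero, neg_zero, zero_smul]; exact Submodule.zero_mem _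
          · exact Submodule.smul_of_tower_mem _ _
              (Submodule.subset_span (Or.inl (Or.inr ⟨r - 1, by omega, y, rfl⟩)))
        · rw [map_sub, DiffPoly.δ_one, sub_zero, derivUA, SuperEnv.deriv_even, affDeriv_central,
            map_zero]
          exact Submodule.zero_mem _

/-- The sign `(-1)^p`. -/
def paritySign (p : ZMod 2) : ℂ := if p = 0 then 1 else -1

/-- The state-field correspondence of the vertex superalgebra `V^k(𝔞)`: `IsField p a A` says that
the state `a` is homogeneous of parity `p` with `Y(a, z) = ∑ₙ A n z^(-n-1)`, that is, `A n v` is the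
product `a_(n) v`. The vacuum corresponds to the identity field, a generator `x[-1]|0⟩` to the field
`∑ₙ x[n] z^(-n-1)`, the state `D a` to the derivative of the field, and the state `a_(-1) b` to the
normally ordered product of the fields. The two sums below have finitely many nonzero terms. -/
inductive IsField : ZMod 2 → VA N k → (ℤ → VA N k → VA N k) → Prop
  | vac : IsField 0 (vacA N k) fun n v => if n = -1 then v else 0
  | even (x : lowerTri N) :
      IsField 0 (evenMode k (-1) x • vacA N k) fun n v => evenMode k n x • v
  | odd (y : strictTri N) :
      IsField 1 (oddMode k (-1) y • vacA N k) fun n v => oddMode k n y • v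
  | deriv {p a A} : IsField p a A →
      IsField p (transl N k a) fun n v => -(n : ℂ) • A (n - 1) v
  | normal {p q a b A B} : IsField p a A → IsField q b B →
      IsField (p + q) (A (-1) b) fun n v =>
        ∑ᶠ j : ℕ, A (-1 - j) (B (n + j) v) +
          paritySign (p * q) • ∑ᶠ j : ℕ, B (n - 1 - j) (A j v)
  | add {p a b A B} : IsField p a A → IsField p b B → IsField p (a + b) fun n v => A n v + B n v
  | smul {p a A} (c : ℂ) : IsField p a A → IsField p (c • a) fun n v => c • A n v

/-- The parameter `α = k + N - 1`. -/
def alpha : ℂ := k + N - 1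

variable {N} in
/-- The element `ψ_{ji}[m] = e_{ji} t^(m-1)`, which is zero unless `j > i`. -/
def psi (j i : Fin N) (m : ℤ) : UA N k := oddMode k (m - 1) (eM j i)

/-- The graph of the differential `Q` of `V^k(𝔞)`: `BRSTGraph N k v u` means `Q v = u`. It is the
least linear relation with the properties which determine `Q`: `Q` is an odd derivation with respect
to the product `a_(-1) b`, it commutes with `D`, and it has the given values on the generators
`e_{ji}[-1]` and `ψ_{ji}[0]`. Every linear map `Q` with these properties contains this relation in
its graph, and the relation is defined on all of `V^k(𝔞)`, as the generators generate it under `D`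
and the product. -/
inductive BRSTGraph : VA N k → VA N k → Prop
  | vac : BRSTGraph (vacA N k) 0
  | even (j i : Fin N) (h : i ≤ j) : BRSTGraph (evenMode k (-1) (eB j i) • vacA N k)
      (∑ a with i ≤ a ∧ a < j, evenMode k (-1) (eB a i) • psi k j a 0 • vacA N k
        - ∑ a with i < a ∧ a ≤ j, psi k a i 0 • evenMode k (-1) (eB j a) • vacA N k
        + alpha N k • psi k j i (-1) • vacA N k
        + ∑ a with a.val = j.val + 1, psi k a i 0 • vacA N k
        - ∑ a with a.val + 1 = i.val, psi k j a 0 • vacA N k)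
  | odd (j i : Fin N) (h : i < j) : BRSTGraph (psi k j i 0 • vacA N k)
      ((1 / 2 : ℂ) • ∑ r with i < r ∧ r < j,
        (psi k j r 0 • psi k r i 0 • vacA N k - psi k r i 0 • psi k j r 0 • vacA N k))
  | transl {v u} : BRSTGraph v u → BRSTGraph (transl N k v) (transl N k u)
  | mul {p a a' b b' A A'} : BRSTGraph a a' → BRSTGraph b b' → IsField N k p a A →
      IsField N k (p + 1) a' A' → BRSTGraph (A (-1) b) (A' (-1) b + paritySign p • A (-1) b')
  | add {v v' u u'} : BRSTGraph v u → BRSTGraph v' u' → BRSTGraph (v + v') (u + u')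
  | smul {v u} (c : ℂ) : BRSTGraph v u → BRSTGraph (c • v) (c • u)

/-- The principal `W`-algebra `W^k(𝔤𝔩_N) = {v ∈ V^k(𝔟) | Q v = 0}`. -/
def principalW : Submodule ℂ (VacMod (formB N k)) where
  carrier := {v | BRSTGraph N k (inclA N k v) 0}
  add_mem' {v w} hv hw := by
    have := BRSTGraph.add hv hw
    rwa [← map_add, add_zero] at this
  zero_mem' := by
    have := BRSTGraph.smul (0 : ℂ) (BRSTGraph.vac (N := N) (k := k))
    rw [zero_smul, smul_zero] at this
    change BRSTGraph N k (inclA N k 0) 0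
    rwa [map_zero]
  smul_mem' c v hv := by
    have := BRSTGraph.smul c hv
    rwa [← map_smul, smul_zero] at this

/-- The Miura transformation `ν : W^k(𝔤𝔩_N) → V^k(𝔩)`, the restriction of the homomorphism
`V^k(𝔟) → V^k(𝔩)` induced by the projection `𝔟 → 𝔩`. -/
def miura : principalW N k →ₗ[ℂ] VacMod (formL N k) :=
  (vacMap (formB N k) (formL N k) (diagProj N) (formL_diagProj N k)).domRestrict (principalW N k)

variable {N} in
/-- The column-determinant `∑_σ sgn σ · a_{σ(1) 1} ⋯ a_{σ(N) N}`. -/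
def cdet {R : Type*} [Ring R] (A : Matrix (Fin N) (Fin N) R) : R :=
  ∑ σ : Equiv.Perm (Fin N), (Equiv.Perm.sign σ : ℤ) • (List.ofFn fun j => A (σ j) j).prod

variable {N} in
/-- The matrix with the entries `T + e_{ii}` on the diagonal, `e_{ij}` below the diagonal, `-1`
right above the diagonal, and `0` elsewhere. -/
def matB {R : Type*} [Ring R] (T : R) (e : Fin N → Fin N → R) : Matrix (Fin N) (Fin N) R :=
  Matrix.of fun i j => if i = j then T + e i i else if j < i then e i j
    else if i.val + 1 = j.val then -1 else 0

/-- The element `W^(r)` of `U(𝔟[t⁻¹]t⁻¹)`: the coefficient of `T^(N-r)` in the column-determinant of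
the matrix with `T + e_{ii}[-1]` on the diagonal, where `T` stands for `ατ`, so that `T` satisfies
the relation `T u - u T = α [τ, u]`. -/
def genW (r : ℕ) : UNeg (formB N k) :=
  (cdet (matB (DiffPoly.tau ((adTau (formB N k)).smul (alpha N k))) fun i j =>
    DiffPoly.const _ (cur (formB N k) (eB i j)))).coeff (N - r)

end Principal

end PrincipalW
end

open PrincipalW

/-!
Number rows and columns from `0`, and let `w_m` be the column-determinant of the block of `B` formed
by the rows and columns `≥ m`, so that `w_0 = cdet B` and `w_N = 1`. As the entries above the
diagonal are `-1` right above it and `0` elsewhere, the expansion along the first column is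
`w_m = T w_{m+1} + ∑_{j ≥ m} e_{jm}[-1] w_{j+1}` (`trailDet_rec`). All assertions follow from this
recursion by downward induction on `m`.

For the membership in the `W`-algebra, apply the coefficients of `w_m` to the vacuum; `T` then acts
through the shift of coefficients and the operator `αD`, where `D` is the translation operator
(`trailState_rec`). The claim is
`Q w_m = -∑_j ψ_{j,m-1}[0] w_{j+1}` (`brst_trailState`), whose right-hand side is empty for `m = 0`.
The induction step needs the product of `Q e_{jm}[-1]` with `w_{j+1}`. The fields `:e_{am} ψ_{ja}:`
and `:ψ_{am} e_{ja}:` contribute, besides the naive products of modes, corrections involving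
nonnegative modes. But `w_{j+1}` only contains `e_{pq}` with `p ≥ q > j`, so these modes kill it,
except for those of the diagonal elements, where the central term occurs; there the corrections of
`e_{mm} ψ_{jm}` and `ψ_{jm} e_{jj}` cancel, as the form takes the same value on `(e_{mm}, e_{pp})`
and on `(e_{jj}, e_{pp})` (`hasProd_naiveQ`). What is left is an identity between sums
(`trailPsi_rec`): the terms `e ψ` cancel against `e_{jm}[-1] Q w_{j+1}`, the terms `α ψ_{jm}[-1]`
against `[αD, ψ_{jm}[0]]`, and the remaining ones recombine by the recursion for `w`. Since `Q` is
given by its graph, the proof never needs that the graph is single-valued.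

The Miura map is induced by a homomorphism of enveloping algebras which commutes with `ad τ` and
kills `e_{jm}[-1]` for `j > m`; it turns the recursion into `z_m = (T + e_{mm}[-1]) z_{m+1}`, that is
into the ordered product (`map_coeff_trailDet`, `trailDet_diagonal`). Finally, sending `T` to `ατ` is
compatible with the recursion (`substSmul_trailDet`), which transfers the identities to `ατ`.
-/

noncomputable section

namespace PrincipalW

/-! ### Column-determinants of almost triangular matrices over a noncommutative ring -/

section

section ColumnDeterminant

variable {R : Type*} [Ring R]

lemma cdet_fin_zero (A : Matrix (Fin 0) (Fin 0) R) : cdet A = 1 := by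
  simp [cdet]

/-- Permuting the rows multiplies a column-determinant by the sign. The order of the factors is
governed by the columns, so commutativity of the entries is not needed. -/
lemma cdet_permute {n : ℕ} (τ : Equiv.Perm (Fin n)) (A : Matrix (Fin n) (Fin n) R) :
    cdet (A.submatrix τ id) = (Equiv.Perm.sign τ : ℤ) • cdet A := by
  rw [cdet, cdet, Finset.smul_sum]
  refine Fintype.sum_equiv (Equiv.mulLeft τ) _ _ fun σ => ?_
  have h : ((Equiv.Perm.sign τ : ℤ) * (Equiv.Perm.sign τ : ℤ)) = 1 := by
    rw [← Units.val_mul, Int.units_mul_self, Units.val_one]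
  simp only [Equiv.coe_mulLeft, Equiv.Perm.sign_mul, Units.val_mul, smul_smul, ← mul_assoc, h,
    one_mul, Matrix.submatrix_apply, id, Equiv.Perm.mul_apply]

/-- Expansion of a column-determinant along the first column, which holds over any ring because the
entries of the first column are the leftmost factors. -/
lemma cdet_succ_column_zero {n : ℕ} (A : Matrix (Fin (n + 1)) (Fin (n + 1)) R) :
    cdet A = ∑ i : Fin (n + 1),
      (-1) ^ (i : ℕ) * (A i 0 * cdet (A.submatrix i.succAbove Fin.succ)) := by
  rw [cdet, Finset.univ_perm_fin_succ, ← Finset.univ_product_univ]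
  simp only [Finset.sum_map, Equiv.toEmbedding_apply, Finset.sum_product]
  refine Finset.sum_congr rfl fun i _ => Fin.cases ?_ (fun i => ?_) i
  · simp only [cdet, List.ofFn_succ, List.prod_cons, Finset.mul_sum, Matrix.submatrix_apply,
      Equiv.Perm.decomposeFin_symm_apply_zero, Fin.val_zero, one_mul,
      Equiv.Perm.decomposeFin.symm_sign, Equiv.swap_self, if_true,
      Equiv.Perm.decomposeFin_symm_apply_succ, Fin.succAbove_zero, Equiv.coe_refl, pow_zero,
      mul_smul_comm, id]
  -- The permutations with `σ 0 = i + 1` are parametrized so that the rows of the minor appear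
  -- permuted by a cycle, whose sign is the one of the expansion.
  · have hs : cdet (A.submatrix i.succ.succAbove Fin.succ) = (Equiv.Perm.sign i.cycleRange : ℤ) •
        cdet ((A.submatrix i.succ.succAbove Fin.succ).submatrix i.cycleRange id) := by
      rw [cdet_permute, smul_smul, ← Units.val_mul, Int.units_mul_self, Units.val_one, one_smul]
    have hc : ((Equiv.Perm.sign i.cycleRange : ℤ)) = (-1) ^ (i : ℕ) := by simp [Fin.sign_cycleRange]
    have h2 : ∀ x : R, (-1 : R) ^ (i.succ : ℕ) * ((-1 : ℤ) ^ (i : ℕ) • x) = -x := by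
      intro x
      rw [Fin.val_succ, pow_succ, zsmul_eq_mul]
      rcases Nat.even_or_odd (i : ℕ) with h | h <;> simp [h.neg_one_pow]
    rw [hs, hc, mul_smul_comm, h2, cdet, Finset.mul_sum, ← Finset.sum_neg_distrib]
    refine Finset.sum_congr rfl fun σ _ => ?_
    rw [Equiv.Perm.decomposeFin.symm_sign, if_neg (Fin.succ_ne_zero i)]
    simp only [List.ofFn_succ, List.prod_cons, Fin.succAbove_cycleRange, Matrix.submatrix_apply, id,
      Equiv.Perm.decomposeFin_symm_apply_zero, Equiv.Perm.decomposeFin_symm_apply_succ,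
      mul_smul_comm, Units.val_neg, neg_one_mul, neg_smul]

lemma cdet_eq_zero_of_row_eq_zero {n : ℕ} (A : Matrix (Fin n) (Fin n) R) (i : Fin n)
    (h : ∀ j, A i j = 0) : cdet A = 0 := by
  rw [cdet]
  refine Finset.sum_eq_zero fun σ _ => ?_
  rw [List.prod_eq_zero, smul_zero]
  exact List.mem_ofFn.2 ⟨σ.symm i, by rw [Equiv.apply_symm_apply, h]⟩

lemma cdet_of_first_row {n : ℕ} (A : Matrix (Fin (n + 1)) (Fin (n + 1)) R)
    (h : ∀ j : Fin n, A 0 j.succ = 0) :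
    cdet A = A 0 0 * cdet (A.submatrix Fin.succ Fin.succ) := by
  rw [cdet_succ_column_zero, Finset.sum_eq_single 0]
  · simp
  · rintro i - hi
    obtain ⟨i, rfl⟩ := Fin.exists_succ_eq.2 hi
    obtain ⟨n, rfl⟩ : ∃ m, n = m + 1 := ⟨n - 1, by have := i.2; omega⟩
    rw [cdet_eq_zero_of_row_eq_zero _ 0, mul_zero, mul_zero]
    intro j
    rw [Matrix.submatrix_apply, Fin.succ_succAbove_zero, h]
  · simp

/-- The column-determinant of the block of `matB T e` formed by the rows and columns with
(zero-based) index at least `m`. -/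
def trailDet (T : R) : (N : ℕ) → (Fin N → Fin N → R) → ℕ → R
  | 0, _, _ => 1
  | _ + 1, e, 0 => cdet (matB T e)
  | N + 1, e, m + 1 => trailDet T N (fun i j => e i.succ j.succ) m

lemma trailDet_zero (T : R) {N : ℕ} (e : Fin N → Fin N → R) :
    trailDet T N e 0 = cdet (matB T e) := by
  cases N with
  | zero => rw [trailDet, cdet_fin_zero]
  | succ N => rw [trailDet]

lemma trailDet_self (T : R) {N : ℕ} (e : Fin N → Fin N → R) : trailDet T N e N = 1 := by
  induction N with
  | zero => rw [trailDet]
  | succ N ih => rw [trailDet, ih]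

lemma matB_submatrix_succ (T : R) {N : ℕ} (e : Fin (N + 1) → Fin (N + 1) → R) :
    (matB T e).submatrix Fin.succ Fin.succ = matB T fun i j => e i.succ j.succ := by
  ext i j
  simp [matB]

/-- Deleting the first column and the row `j` from `matB T e` leaves a matrix which, up to the
entries `-1` in its first `j` columns, is the block of the rows and columns after `j`. -/
lemma cdet_matB_minor (T : R) {N : ℕ} (e : Fin (N + 1) → Fin (N + 1) → R) (j : Fin (N + 1)) :
    cdet ((matB T e).submatrix j.succAbove Fin.succ) =
      (-1) ^ (j : ℕ) * trailDet T (N + 1) e (j + 1) := by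
  induction N with
  | zero =>
    obtain rfl : j = 0 := Fin.fin_one_eq_zero j
    simp [cdet_fin_zero, trailDet]
  | succ N ih =>
    induction j using Fin.cases with
    | zero =>
      rw [Fin.succAbove_zero, matB_submatrix_succ, Fin.val_zero, pow_zero, one_mul, zero_add,
        trailDet, trailDet]
    | succ j =>
      rw [cdet_of_first_row, Matrix.submatrix_submatrix]
      · have h1 : (matB T e).submatrix (j.succ.succAbove ∘ Fin.succ) (Fin.succ ∘ Fin.succ) =
            ((matB T e).submatrix Fin.succ Fin.succ).submatrix j.succAbove Fin.succ := by
          ext a b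
          simp only [Matrix.submatrix_apply, Function.comp_apply, Fin.succ_succAbove_succ]
        rw [h1, matB_submatrix_succ, ih, Fin.val_succ, pow_succ']
        have h2 : (matB T e).submatrix j.succ.succAbove Fin.succ 0 0 = -1 := by
          rw [Matrix.submatrix_apply, Fin.succ_succAbove_zero]
          simp [matB]
        rw [h2, mul_assoc, trailDet.eq_3 T (N + 1)]
      · intro b
        rw [Matrix.submatrix_apply, Fin.succ_succAbove_zero]
        simp [matB, Fin.ext_iff]

/-- The expansion of `trailDet` along its first column: as the entries above the diagonal are `-1`
right above it and `0` elsewhere, all signs cancel. -/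
lemma trailDet_rec (T : R) {N : ℕ} (e : Fin N → Fin N → R) (he : ∀ i j, i < j → e i j = 0)
    (m : Fin N) :
    trailDet T N e m = T * trailDet T N e (m + 1) + ∑ j, e j m * trailDet T N e (j + 1) := by
  induction N with
  | zero => exact m.elim0
  | succ N ih =>
    induction m using Fin.cases with
    | zero =>
      have hs : ∀ (i : Fin (N + 1)) (x : R),
          (-1 : R) ^ (i : ℕ) * (matB T e i 0 * ((-1) ^ (i : ℕ) * x)) = matB T e i 0 * x := by
        intro i x
        rcases Nat.even_or_odd (i : ℕ) with h | h
        · rw [h.neg_one_pow, one_mul, one_mul]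
        · rw [h.neg_one_pow, neg_one_mul, neg_one_mul, mul_neg, neg_neg]
      rw [Fin.val_zero, trailDet, cdet_succ_column_zero]
      simp only [cdet_matB_minor, hs]
      rw [Fin.sum_univ_succ, Fin.sum_univ_succ, ← add_assoc, Fin.val_zero, ← add_mul]
      simp [matB]
    | succ m =>
      rw [Fin.val_succ, trailDet, ih _ fun i j h => he _ _ (Fin.succ_lt_succ_iff.2 h),
        Fin.sum_univ_succ, he _ _ (Fin.succ_pos m), zero_mul, zero_add, trailDet]
      simp only [Fin.val_succ, trailDet]

end ColumnDeterminant

end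

/-! ### Coefficients in differential polynomial algebras -/

section

/-- Induction from `N` down to `0`, where a step may use all larger values. -/
lemma downward_induction {N : ℕ} {P : ℕ → Prop} (hN : P N)
    (h : ∀ m : Fin N, (∀ j, m.val < j → j ≤ N → P j) → P m) {m : ℕ} (hm : m ≤ N) : P m := by
  induction hd : N - m using Nat.strong_induction_on generalizing m with
  | _ d ih =>
    rcases hm.eq_or_lt with rfl | hlt
    · exact hN
    · exact h ⟨m, hlt⟩ fun j hj hjN => ih (N - j) (by simp at hj; omega) hjN rfl

namespace DiffPoly

variable {A : Type*} [Ring A] [Algebra ℂ A] (δ : AlgDer A)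

/-- The coefficient of `τⁿ` as a linear map. -/
def coeffLin (n : ℕ) : DiffPoly δ →ₗ[ℂ] A := (Polynomial.lcoeff A n).restrictScalars ℂ

variable {δ}

lemma coeff_add (p q : DiffPoly δ) (n : ℕ) : (p + q).coeff n = p.coeff n + q.coeff n :=
  (coeffLin δ n).map_add p q

lemma coeff_sum {ι : Type*} (s : Finset ι) (f : ι → DiffPoly δ) (n : ℕ) :
    (∑ i ∈ s, f i).coeff n = ∑ i ∈ s, (f i).coeff n :=
  map_sum (coeffLin δ n) f s

lemma coeff_one (n : ℕ) : (1 : DiffPoly δ).coeff n = if n = 0 then 1 else 0 := by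
  change Polynomial.coeff (1 : Polynomial A) n = _
  rw [Polynomial.coeff_one]

lemma const_mul (a : A) (p : DiffPoly δ) : const δ a * p = lmul a p := by
  change lmulPoly δ (Polynomial.C a) p = _
  rw [← Polynomial.monomial_zero_left, lmulPoly_monomial, pow_zero, mul_one]

lemma tau_mul (p : DiffPoly δ) : tau δ * p = lmulTau δ p := by
  change lmulPoly δ Polynomial.X p = _
  have : (lmul (1 : A) : Module.End ℂ (Polynomial A)) = 1 := by
    refine LinearMap.ext fun q => ?_
    simp [lmul]
  rw [← Polynomial.monomial_one_one_eq_X, lmulPoly_monomial, pow_one, this, one_mul]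

lemma coeff_const_mul (a : A) (p : DiffPoly δ) (n : ℕ) :
    (const δ a * p).coeff n = a * p.coeff n := by
  rw [const_mul]
  exact Polynomial.coeff_C_mul _

/-- The coefficients of `τ p`, written with a case distinction for the shifted part. -/
lemma coeff_tau_mul (p : DiffPoly δ) (n : ℕ) :
    (tau δ * p).coeff n = (if n = 0 then 0 else p.coeff (n - 1)) + δ.toLin (p.coeff n) := by
  rw [tau_mul]
  change Polynomial.coeff (lmulTau δ p) n = _
  unfold coeff
  induction p using Polynomial.induction_on' with
  | add p q hp hq =>
    rw [map_add, Polynomial.coeff_add, hp, hq, Polynomial.coeff_add, Polynomial.coeff_add, map_add]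
    split_ifs <;> abel
  | monomial i a =>
    rw [lmulTau_monomial, Polynomial.coeff_add]
    simp only [Polynomial.coeff_monomial]
    rcases n with _ | n
    · simp [apply_ite δ.toLin]
    · simp [apply_ite δ.toLin]

variable (δ) in
/-- The homomorphism which sends the variable `T` with `[T, a] = c δ(a)` to `c τ`, as a linear
map. -/
def substSmul (c : ℂ) : DiffPoly (δ.smul c) →ₗ[ℂ] DiffPoly δ :=
  Polynomial.lsum (R := ℂ) (A := A) fun n =>
    (LinearMap.mulRight ℂ ((c • tau δ) ^ n)).comp
      ({ toFun := const δ
         map_add' := fun _ _ => Polynomial.C_add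
         map_smul' := fun x a => (Polynomial.smul_C x a).symm } : A →ₗ[ℂ] DiffPoly δ)

lemma substSmul_monomial (c : ℂ) (n : ℕ) (a : A) :
    substSmul δ c (Polynomial.monomial n a : Polynomial A) = const δ a * (c • tau δ) ^ n := by
  unfold substSmul
  erw [Polynomial.lsum_apply]
  rw [Polynomial.sum_monomial_index _ _ (by simp)]
  rfl

lemma substSmul_one (c : ℂ) : substSmul δ c 1 = 1 := by
  have := substSmul_monomial (δ := δ) c 0 1
  rw [pow_zero, mul_one] at this
  exact this

lemma substSmul_const_mul (c : ℂ) (a : A) (p : DiffPoly (δ.smul c)) :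
    substSmul δ c (const _ a * p) = const δ a * substSmul δ c p := by
  rw [const_mul]
  induction p using Polynomial.induction_on' with
  | add p q hp hq =>
    have h1 := (substSmul δ c).map_add (lmul a p) (lmul a q)
    have h2 := (substSmul δ c).map_add p q
    rw [map_add]
    exact h1.trans (by rw [hp, hq, ← mul_add]; exact congrArg _ h2.symm)
  | monomial n b =>
    rw [lmul_monomial, substSmul_monomial, substSmul_monomial, ← mul_assoc, const_mul_const]

lemma substSmul_tau_mul (c : ℂ) (p : DiffPoly (δ.smul c)) :
    substSmul δ c (tau _ * p) = c • tau δ * substSmul δ c p := by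
  rw [tau_mul]
  induction p using Polynomial.induction_on' with
  | add p q hp hq =>
    have h1 := (substSmul δ c).map_add (lmulTau (δ.smul c) p) (lmulTau (δ.smul c) q)
    have h2 := (substSmul δ c).map_add p q
    rw [map_add]
    exact h1.trans (by rw [hp, hq, ← mul_add]; exact congrArg _ h2.symm)
  | monomial n b =>
    have h1 := (substSmul δ c).map_add (Polynomial.monomial (n + 1) b : Polynomial A)
      (Polynomial.monomial n ((δ.smul c).toLin b) : Polynomial A)
    rw [lmulTau_monomial]
    refine h1.trans ?_
    have h2 : const δ ((δ.smul c).toLin b) = c • const δ (δ.toLin b) :=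
      (Polynomial.smul_C c _).symm
    rw [substSmul_monomial, substSmul_monomial, substSmul_monomial, ← mul_assoc, smul_mul_assoc,
      tau_mul_const, h2, smul_add, add_mul, pow_succ', ← mul_assoc, mul_smul_comm]

lemma substSmul_eq_sum (c : ℂ) (p : DiffPoly (δ.smul c)) {N : ℕ}
    (hp : ∀ n, N < n → p.coeff n = 0) :
    substSmul δ c p =
      ∑ r ∈ Finset.range (N + 1), const δ (p.coeff (N - r)) * (c • tau δ) ^ (N - r) := by
  have hd : Polynomial.natDegree (p : Polynomial A) < N + 1 :=
    Nat.lt_succ_of_le (Polynomial.natDegree_le_iff_coeff_eq_zero.2 hp)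
  have h := Polynomial.as_sum_range' (p : Polynomial A) (N + 1) hd
  have h2 : substSmul δ c p = ∑ n ∈ Finset.range (N + 1),
      substSmul δ c (Polynomial.monomial n (p.coeff n) : Polynomial A) :=
    (congrArg (substSmul δ c) h).trans (map_sum (substSmul δ c) _ _)
  rw [h2, ← Finset.sum_range_reflect]
  refine Finset.sum_congr rfl fun r _ => ?_
  rw [substSmul_monomial, Nat.add_sub_cancel]

section MapCoeff

variable {V : Type*} [AddCommGroup V] [Module ℂ V] (f : A →ₗ[ℂ] V)

lemma mapCoeff_monomial (n : ℕ) (a : A) :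
    mapCoeff (δ := δ) f (Polynomial.monomial n a : Polynomial A) =
      f a ⊗ₜ[ℂ] (Polynomial.X ^ n : Polynomial ℂ) := by
  unfold mapCoeff
  erw [Polynomial.lsum_apply]
  rw [Polynomial.sum_monomial_index _ _ (by simp)]
  rfl

lemma const_mul_tau_pow (a : A) (n : ℕ) :
    const δ a * tau δ ^ n = (Polynomial.monomial n a : Polynomial A) := by
  rw [const_mul]
  have : ∀ n : ℕ, tau δ ^ n = (Polynomial.monomial n 1 : Polynomial A) := by
    intro n
    induction n with
    | zero => rfl
    | succ n ih =>
      rw [pow_succ', tau_mul]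
      refine (congrArg (lmulTau δ) ih).trans ?_
      rw [lmulTau_monomial, δ_one, map_zero, add_zero]
  rw [this, lmul_monomial, mul_one]

lemma mapCoeff_eq_sum (p : DiffPoly δ) {N : ℕ} (hp : ∀ n, N < n → p.coeff n = 0) :
    mapCoeff f p = ∑ r : Fin (N + 1),
      f (p.coeff (N - r)) ⊗ₜ[ℂ] (Polynomial.X ^ (N - r.val) : Polynomial ℂ) := by
  have hd : Polynomial.natDegree (p : Polynomial A) < N + 1 :=
    Nat.lt_succ_of_le (Polynomial.natDegree_le_iff_coeff_eq_zero.2 hp)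
  have h := Polynomial.as_sum_range' (p : Polynomial A) (N + 1) hd
  have h2 : mapCoeff f p = ∑ n ∈ Finset.range (N + 1),
      mapCoeff (δ := δ) f (Polynomial.monomial n (p.coeff n) : Polynomial A) :=
    (congrArg (mapCoeff (δ := δ) f) h).trans (map_sum (mapCoeff (δ := δ) f) _ _)
  rw [h2, ← Finset.sum_range_reflect, Finset.sum_range]
  refine Finset.sum_congr rfl fun r _ => ?_
  rw [mapCoeff_monomial, Nat.add_sub_cancel]

lemma mapCoeff_substSmul (c : ℂ) (p : DiffPoly (δ.smul c)) {N : ℕ}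
    (hp : ∀ n, N < n → p.coeff n = 0) :
    mapCoeff f (substSmul δ c p) = ∑ r : Fin (N + 1),
      f (p.coeff (N - r)) ⊗ₜ[ℂ] ((c • Polynomial.X) ^ (N - r.val) : Polynomial ℂ) := by
  rw [substSmul_eq_sum c p hp, map_sum, Finset.sum_range]
  refine Finset.sum_congr rfl fun r _ => ?_
  rw [smul_pow, smul_pow, mul_smul_comm, map_smul, TensorProduct.tmul_smul, const_mul_tau_pow]
  exact congrArg _ (mapCoeff_monomial f _ _)

end MapCoeff

section TrailDet

variable {N : ℕ} {e : Fin N → Fin N → A}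

lemma coeff_trailDet (he : ∀ i j, i < j → e i j = 0) (m : Fin N) (n : ℕ) :
    (trailDet (tau δ) N (fun i j => const δ (e i j)) m).coeff n =
      (if n = 0 then 0 else
        (trailDet (tau δ) N (fun i j => const δ (e i j)) (m + 1)).coeff (n - 1)) +
      δ.toLin ((trailDet (tau δ) N (fun i j => const δ (e i j)) (m + 1)).coeff n) +
      ∑ j, e j m * (trailDet (tau δ) N (fun i j => const δ (e i j)) (j + 1)).coeff n := by
  rw [trailDet_rec _ _ (fun i j h => by rw [he i j h]; exact Polynomial.C_0), coeff_add,
    coeff_tau_mul, coeff_sum]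
  simp only [coeff_const_mul]

/-- The column-determinant of the block is monic of degree equal to the size of the block. -/
lemma trailDet_monic (he : ∀ i j, i < j → e i j = 0) {m : ℕ} (hm : m ≤ N) :
    (trailDet (tau δ) N (fun i j => const δ (e i j)) m).coeff (N - m) = 1 ∧
      ∀ n, N - m < n → (trailDet (tau δ) N (fun i j => const δ (e i j)) m).coeff n = 0 := by
  refine downward_induction (P := fun m =>
    (trailDet (tau δ) N (fun i j => const δ (e i j)) m).coeff (N - m) = 1 ∧
      ∀ n, N - m < n → (trailDet (tau δ) N (fun i j => const δ (e i j)) m).coeff n = 0) ?_ ?_ hm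
  · simp only [trailDet_self, coeff_one, Nat.sub_self, if_true, true_and]
    exact fun n hn => if_neg hn.ne'
  · intro m ih
    have h1 := ih (m + 1) (by omega) (by omega)
    have h2 : ∀ n, N - m.val ≤ n →
        ∑ j, e j m * (trailDet (tau δ) N (fun i j => const δ (e i j)) (j + 1)).coeff n = 0 := by
      intro n hn
      refine Finset.sum_eq_zero fun j _ => ?_
      rcases lt_or_ge j m with h | h
      · rw [he _ _ h, zero_mul]
      · have : m.val ≤ j.val := h
        rw [(ih (j + 1) (by omega) (by omega)).2 n (by omega), mul_zero]
    have hm := m.2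
    refine ⟨?_, fun n hn => ?_⟩
    · rw [coeff_trailDet he, h2 _ le_rfl, if_neg (by omega), h1.2 (N - m) (by omega), map_zero, add_zero,
        add_zero, show N - m.val - 1 = N - (m + 1) by omega, h1.1]
    · rw [coeff_trailDet he, h2 _ hn.le, if_neg (by omega), h1.2 _ (by omega), h1.2 _ (by omega),
        map_zero, add_zero, add_zero]

lemma substSmul_trailDet (c : ℂ) (he : ∀ i j, i < j → e i j = 0) {m : ℕ} (hm : m ≤ N) :
    substSmul δ c (trailDet (tau (δ.smul c)) N (fun i j => const _ (e i j)) m) =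
      trailDet (c • tau δ) N (fun i j => const δ (e i j)) m := by
  refine downward_induction (P := fun m =>
    substSmul δ c (trailDet (tau (δ.smul c)) N (fun i j => const _ (e i j)) m) =
      trailDet (c • tau δ) N (fun i j => const δ (e i j)) m) ?_ ?_ hm
  · simp only [trailDet_self, substSmul_one]
  · intro m ih
    rw [trailDet_rec _ _ (fun i j h => by rw [he i j h]; exact Polynomial.C_0),
      trailDet_rec _ _ (fun i j h => by rw [he i j h]; exact Polynomial.C_0), map_add, map_sum,
      substSmul_tau_mul, ih _ (by omega) (by omega)]
    refine congrArg _ (Finset.sum_congr rfl fun j _ => ?_)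
    rw [substSmul_const_mul]
    rcases lt_or_ge j m with h | h
    · have h0 : const δ (0 : A) = 0 := Polynomial.C_0
      rw [he _ _ h, h0, zero_mul, zero_mul]
    · have : m.val ≤ j.val := h
      rw [ih _ (by omega) (by omega)]

end TrailDet

end DiffPoly

end

/-! ### Modes acting on `V^k(𝔞)`, and matrix units -/

section

section Enveloping

/-- Two derivations along a homomorphism from an enveloping algebra agree if they agree on the Lie
algebra. -/
lemma env_deriv_comm {L B : Type*} [LieRing L] [LieAlgebra ℂ L] [Ring B] [Algebra ℂ B]
    (δ : AlgDer (UniversalEnvelopingAlgebra ℂ L)) (δ' : AlgDer B)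
    (F : UniversalEnvelopingAlgebra ℂ L →ₐ[ℂ] B)
    (h : ∀ x, F (δ.toLin (UniversalEnvelopingAlgebra.ι ℂ x)) =
      δ'.toLin (F (UniversalEnvelopingAlgebra.ι ℂ x)))
    (u : UniversalEnvelopingAlgebra ℂ L) : F (δ.toLin u) = δ'.toLin (F u) := by
  let S : Subalgebra ℂ (UniversalEnvelopingAlgebra ℂ L) :=
    { carrier := {u | F (δ.toLin u) = δ'.toLin (F u)}
      mul_mem' := fun {a b} ha hb => by
        rw [Set.mem_ofPred_eq] at *
        rw [δ.leibniz, map_add, map_mul, map_mul, ha, hb, map_mul, δ'.leibniz]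
      add_mem' := fun {a b} ha hb => by
        rw [Set.mem_ofPred_eq] at *
        rw [map_add, map_add, ha, hb, map_add, map_add]
      algebraMap_mem' := fun c => by
        rw [Set.mem_ofPred_eq, Algebra.algebraMap_eq_smul_one, map_smul, map_smul, map_smul,
          map_smul, DiffPoly.δ_one, map_one, DiffPoly.δ_one, map_zero] }
  let f : L →ₗ⁅ℂ⁆ S :=
    { toFun := fun x => ⟨UniversalEnvelopingAlgebra.ι ℂ x, h x⟩
      map_add' := fun x y => Subtype.ext (map_add _ x y)
      map_smul' := fun c x => Subtype.ext (map_smul _ c x)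
      map_lie' := fun {x y} => Subtype.ext (LieHom.map_lie _ x y) }
  have hS : S.val.comp (UniversalEnvelopingAlgebra.lift ℂ f) = AlgHom.id ℂ _ := by
    ext x
    simp [f]
  have hu := congrArg (fun g => g u) hS
  simp only [AlgHom.comp_apply, AlgHom.id_apply] at hu
  rw [← hu]
  exact (UniversalEnvelopingAlgebra.lift ℂ f u).2

lemma env_deriv_comm_of_negPart {L B : Type*} [LieRing L] [LieAlgebra ℂ L] [Ring B] [Algebra ℂ B]
    (κ : InvForm L) (δ' : AlgDer B) (F : UNeg κ →ₐ[ℂ] B)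
    (h : ∀ (r : ℤ) (hr : r < 0) (x : L),
      F ((adTau κ).toLin (UniversalEnvelopingAlgebra.ι ℂ (negMode κ r hr x))) =
        δ'.toLin (F (UniversalEnvelopingAlgebra.ι ℂ (negMode κ r hr x))))
    (u : UNeg κ) : F ((adTau κ).toLin u) = δ'.toLin (F u) := by
  refine env_deriv_comm _ _ F (fun x => ?_) u
  obtain ⟨x, hx⟩ := x
  induction hx using Submodule.span_induction with
  | mem x hx =>
    obtain ⟨r, hr, y, rfl⟩ := hx
    exact h r hr y
  | zero =>
    have h0 : UniversalEnvelopingAlgebra.ι ℂ (0 : negPart κ) = 0 := map_zero _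
    exact (congrArg (fun z => F ((adTau κ).toLin z)) h0).trans
      ((by simp : F ((adTau κ).toLin 0) = δ'.toLin (F 0)).trans
        (congrArg (fun z => δ'.toLin (F z)) h0.symm))
  | add x y hx hy ihx ihy =>
    have h0 : UniversalEnvelopingAlgebra.ι ℂ (⟨x + y, add_mem hx hy⟩ : negPart κ) =
        UniversalEnvelopingAlgebra.ι ℂ (⟨x, hx⟩ : negPart κ) +
          UniversalEnvelopingAlgebra.ι ℂ (⟨y, hy⟩ : negPart κ) :=
      map_add (UniversalEnvelopingAlgebra.ι ℂ) (⟨x, hx⟩ : negPart κ) ⟨y, hy⟩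
    rw [h0, map_add, map_add, ihx, ihy, map_add, map_add]
  | smul c x hx ih =>
    have h0 : UniversalEnvelopingAlgebra.ι ℂ
        (⟨c • x, Submodule.smul_mem _ c hx⟩ : negPart κ) =
        c • UniversalEnvelopingAlgebra.ι ℂ (⟨x, hx⟩ : negPart κ) :=
      map_smul (UniversalEnvelopingAlgebra.ι ℂ) c (⟨x, hx⟩ : negPart κ)
    rw [h0, map_smul, map_smul, ih, map_smul, map_smul]

end Enveloping

variable {N : ℕ} {k : ℂ}

section Modes

lemma VA.mk_surjective (v : VA N k) : ∃ u : UA N k, VA.mk N k u = v :=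
  Submodule.mkQ_surjective _ v

lemma transl_mk (u : UA N k) : transl N k (VA.mk N k u) = VA.mk N k ((derivUA N k).toLin u) := rfl

lemma transl_smul (a : UA N k) (v : VA N k) :
    transl N k (a • v) = (derivUA N k).toLin a • v + a • transl N k v := by
  obtain ⟨u, rfl⟩ := VA.mk_surjective v
  rw [← map_smul, transl_mk, smul_eq_mul, (derivUA N k).leibniz, map_add, transl_mk, ← map_smul,
    ← map_smul, smul_eq_mul, smul_eq_mul]

lemma transl_vac : transl N k (vacA N k) = 0 := by
  rw [vacA, transl_mk, DiffPoly.δ_one, map_zero]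

lemma transl_evenMode (n : ℤ) (x : lowerTri N) (v : VA N k) :
    transl N k (evenMode k n x • v) =
      evenMode k n x • transl N k v + -(n : ℂ) • evenMode k (n - 1) x • v := by
  rw [transl_smul, derivUA_evenMode, smul_assoc, add_comm]

lemma transl_oddMode (n : ℤ) (y : strictTri N) (v : VA N k) :
    transl N k (oddMode k n y • v) =
      oddMode k n y • transl N k v + -(n : ℂ) • oddMode k (n - 1) y • v := by
  rw [transl_smul, derivUA_oddMode, smul_assoc, add_comm]

lemma evenMode_sub (n : ℤ) (x y : lowerTri N) :
    evenMode k n (x - y) = evenMode k n x - evenMode k n y := by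
  rw [sub_eq_add_neg, ← neg_one_smul ℂ y, evenMode, mode_add, mode_smul, map_add, map_smul,
    neg_one_smul, ← sub_eq_add_neg]
  rfl

lemma evenMode_zero (n : ℤ) : evenMode k n (0 : lowerTri N) = 0 := by
  simpa using evenMode_sub (k := k) n (0 : lowerTri N) 0

lemma oddMode_zero (n : ℤ) : oddMode k n (0 : strictTri N) = 0 := by
  rw [oddMode, TensorProduct.tmul_zero, map_zero]

lemma evenMode_vac {n : ℤ} (hn : 0 ≤ n) (x : lowerTri N) : evenMode k n x • vacA N k = 0 := by
  rw [vacA, ← map_smul, smul_eq_mul, mul_one]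
  exact VA.mk_eq_zero N k (Submodule.subset_span (Or.inl (Or.inl ⟨n, hn, x, rfl⟩)))

lemma oddMode_vac {n : ℤ} (hn : 0 ≤ n) (y : strictTri N) : oddMode k n y • vacA N k = 0 := by
  rw [vacA, ← map_smul, smul_eq_mul, mul_one]
  exact VA.mk_eq_zero N k (Submodule.subset_span (Or.inl (Or.inr ⟨n, hn, y, rfl⟩)))

lemma evenMode_evenMode (r s : ℤ) (x y : lowerTri N) (v : VA N k) :
    evenMode k r x • evenMode k s y • v =
      evenMode k s y • evenMode k r x • v + evenMode k (r + s) ⁅x, y⁆ • v +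
        (if r + s = 0 then (r : ℂ) * (formB N k).form x y else 0) •
          SuperEnv.even (Aff (formB N k)) (OddLoop N) (central (formB N k)) • v := by
  have h : evenMode k r x * evenMode k s y = evenMode k s y * evenMode k r x +
      evenMode k (r + s) ⁅x, y⁆ + (if r + s = 0 then (r : ℂ) * (formB N k).form x y else 0) •
          SuperEnv.even (Aff (formB N k)) (OddLoop N) (central (formB N k)) := by
    rw [evenMode, evenMode, SuperEnv.even_mul_even, lie_mode, map_add, map_smul, add_comm,
      ← add_assoc]
    rfl
  generalize (if r + s = 0 then (r : ℂ) * (formB N k).form x y else 0) = c at h ⊢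
  refine (mul_smul _ _ v).symm.trans ((congrArg (fun u : UA N k => u • v) h).trans ?_)
  refine (add_smul _ _ v).trans (congrArg₂ _ ((add_smul _ _ v).trans (congrArg₂ _ ?_ rfl)) ?_)
  · exact mul_smul _ _ v
  · exact smul_assoc c _ v

lemma evenMode_oddMode (r s : ℤ) (x : lowerTri N) (y : strictTri N) (v : VA N k) :
    evenMode k r x • oddMode k s y • v =
      oddMode k s y • evenMode k r x • v + oddMode k (r + s) ⁅x, y⁆ • v := by
  have h : evenMode k r x * oddMode k s y = oddMode k s y * evenMode k r x +
      oddMode k (r + s) ⁅x, y⁆ := by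
    have hl : ⁅mode (formB N k) r x, (AddMonoidAlgebra.single s (1 : ℂ) ⊗ₜ[ℂ] y : OddLoop N)⁆ =
        AddMonoidAlgebra.single (r + s) (1 : ℂ) ⊗ₜ[ℂ] ⁅x, y⁆ := by
      change ⁅(AddMonoidAlgebra.single r (1 : ℂ) ⊗ₜ[ℂ] x : loopAlgebra ℂ ℤ (lowerTri N)),
        (AddMonoidAlgebra.single s (1 : ℂ) ⊗ₜ[ℂ] y : OddLoop N)⁆ = _
      rw [ExtendScalars.bracket_tmul, AddMonoidAlgebra.single_mul_single, one_mul]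
    unfold evenMode oddMode
    rw [SuperEnv.even_mul_odd, hl, add_comm]
  rw [smul_smul, h, add_smul, mul_smul]

variable (N k) in
/-- An element of `U(𝔟[t⁻¹]t⁻¹)` regarded as an element of `V^k(𝔞)`. -/
def toVA : UNeg (formB N k) →ₗ[ℂ] VA N k := (inclA N k).comp (UNeg.toVac (formB N k))

variable (N k) in
/-- The inclusion `U(𝔟[t⁻¹]t⁻¹) → U(𝔞̂)`. -/
def negToUA : UNeg (formB N k) →ₐ[ℂ] UA N k :=
  (SuperEnv.ofEven (OddLoop N)).comp (UniversalEnvelopingAlgebra.lift ℂ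
      ((UniversalEnvelopingAlgebra.ι ℂ).comp (negPart (formB N k)).incl))

lemma toVA_apply (u : UNeg (formB N k)) : toVA N k u = VA.mk N k (negToUA N k u) := rfl

lemma negToUA_negMode (r : ℤ) (hr : r < 0) (x : lowerTri N) :
    negToUA N k (UniversalEnvelopingAlgebra.ι ℂ (negMode (formB N k) r hr x)) = evenMode k r x := by
  rw [negToUA, AlgHom.comp_apply, UniversalEnvelopingAlgebra.lift_ι_apply, LieHom.comp_apply,
    SuperEnv.ofEven_ι]
  rfl

lemma toVA_one : toVA N k 1 = vacA N k := by
  rw [toVA_apply, map_one, vacA]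

lemma toVA_cur_mul (x : lowerTri N) (u : UNeg (formB N k)) :
    toVA N k (cur (formB N k) x * u) = evenMode k (-1) x • toVA N k u := by
  rw [toVA_apply, toVA_apply, map_mul, cur, negToUA_negMode, ← smul_eq_mul, map_smul]

lemma toVA_adTau (u : UNeg (formB N k)) :
    toVA N k ((adTau (formB N k)).toLin u) = transl N k (toVA N k u) := by
  rw [toVA_apply, toVA_apply, transl_mk]
  congr 1
  refine env_deriv_comm_of_negPart _ _ (negToUA N k) (fun r hr x => ?_) u
  rw [adTau_mode, map_smul, negToUA_negMode, negToUA_negMode, derivUA_evenMode]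

end Modes

section MatrixUnits

lemma eB_apply (a b i j : Fin N) :
    (eB a b).1 i j = if (a = i ∧ b = j) ∧ b ≤ a then 1 else 0 := by
  unfold eB
  split_ifs with h1 h2 h2
  · exact (Matrix.single_apply ..).trans (if_pos h2.1)
  · exact (Matrix.single_apply ..).trans (if_neg fun h => h2 ⟨h, h1⟩)
  · exact absurd h2.2 h1
  · rfl

lemma eB_of_lt {a b : Fin N} (h : a < b) : eB a b = 0 := dif_neg h.not_ge

lemma eM_of_le {a b : Fin N} (h : a ≤ b) : eM a b = 0 := dif_neg h.not_gt

lemma coe_eM {a b : Fin N} (h : b < a) : ((eM a b : strictTri N) : lowerTri N) = eB a b := by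
  rw [eM, dif_pos h]

lemma eB_lie_eq_zero {a b p q : Fin N} (h1 : b ≠ p) (h2 : q ≠ a) : ⁅eB a b, eB p q⁆ = 0 := by
  refine Subtype.ext ?_
  rw [LieSubalgebra.coe_bracket, LieRing.of_associative_ring_bracket]
  have key : ∀ {a b p q : Fin N}, b ≠ p → (eB a b).1 * (eB p q).1 = 0 := by
    intro a b p q h
    ext i j
    rw [Matrix.mul_apply]
    refine Finset.sum_eq_zero fun l _ => ?_
    rw [eB_apply, eB_apply]
    by_cases hl : b = l
    · rw [if_neg (c := (p = l ∧ _) ∧ _) (fun h' => h (hl.trans h'.1.1.symm)), mul_zero]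
    · rw [if_neg (fun h' => hl h'.1.2), zero_mul]
  rw [key h1, key h2, sub_zero]
  rfl

lemma eB_lie_eM_eq_zero {a b p q : Fin N} (h1 : b ≠ p) (h2 : q ≠ a) : ⁅eB a b, eM p q⁆ = 0 := by
  rcases lt_or_ge q p with h | h
  · refine Subtype.ext ?_
    rw [LieSubmodule.coe_bracket, coe_eM h, eB_lie_eq_zero h1 h2]
    rfl
  · rw [eM_of_le h, lie_zero]

lemma formB_apply (x y : lowerTri N) : (formB N k).form x y =
    (k + N) * (∑ i, x.1 i i * y.1 i i - 1 / N * ((∑ i, x.1 i i) * ∑ i, y.1 i i)) := rfl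

lemma formB_offDiag {a b : Fin N} (h : b ≠ a) (y : lowerTri N) :
    (formB N k).form (eB a b) y = 0 := by
  have h0 : ∀ i, (eB a b).1 i i = 0 := fun i => by
    rw [eB_apply, if_neg fun h' => h (h'.1.2.trans h'.1.1.symm)]
  simp [formB_apply, h0]

/-- The form does not distinguish the diagonal matrix units `e_{aa}` and `e_{bb}` when paired with
elements supported away from the places `a` and `b`. -/
lemma formB_diag_sub {a b : Fin N} {y : lowerTri N} (ha : y.1 a a = 0) (hb : y.1 b b = 0) :
    (formB N k).form (eB a a - eB b b) y = 0 := by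
  have hs : ∀ i, (eB a a - eB b b).1 i i =
      (if a = i then (1 : ℂ) else 0) - if b = i then 1 else 0 := by
    intro i
    change (eB a a).1 i i - (eB b b).1 i i = _
    simp [eB_apply]
  rw [formB_apply]
  simp only [hs]
  simp [sub_mul, Finset.sum_sub_distrib, ha, hb]

end MatrixUnits

end

/-! ### The block determinants as states, and the modes which kill them -/

section

variable {N : ℕ} {k : ℂ}

section TrailingVectors

variable (N k) in
/-- The state of `V^k(𝔞)` given by the coefficient of `Tⁿ` in the column-determinant of the block of
`B` formed by the rows and columns with (zero-based) index at least `m`. -/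
def trailState (m n : ℕ) : VA N k :=
  toVA N k ((trailDet (DiffPoly.tau ((adTau (formB N k)).smul (alpha N k))) N
    fun i j => DiffPoly.const _ (cur (formB N k) (eB i j))) m |>.coeff n)

lemma cur_zero {L : Type*} [LieRing L] [LieAlgebra ℂ L] (κ : InvForm L) : cur κ 0 = 0 := by
  have h : negMode κ (-1) (by norm_num) (0 : L) = 0 :=
    Subtype.ext (show mode κ (-1) (0 : L) = 0 by simpa using mode_smul κ (-1) 0 (0 : L))
  rw [cur, h, map_zero]

lemma cur_eB_of_lt (i j : Fin N) (h : i < j) : cur (formB N k) (eB i j) = 0 := by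
  rw [eB_of_lt h, cur_zero]

lemma trailState_self (n : ℕ) : trailState N k N n = if n = 0 then vacA N k else 0 := by
  rw [trailState, trailDet_self, DiffPoly.coeff_one]
  split_ifs
  · exact toVA_one
  · exact map_zero _

lemma trailState_rec (m : Fin N) (n : ℕ) :
    trailState N k m n = (if n = 0 then 0 else trailState N k (m + 1) (n - 1)) +
      alpha N k • transl N k (trailState N k (m + 1) n) +
      ∑ j, evenMode k (-1) (eB j m) • trailState N k (j + 1) n := by
  have h0 : ∀ u, ((adTau (formB N k)).smul (alpha N k)).toLin u =
    alpha N k • (adTau (formB N k)).toLin u := fun _ => rfl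
  rw [trailState, DiffPoly.coeff_trailDet cur_eB_of_lt, map_add, map_add, map_sum, h0, map_smul,
    toVA_adTau]
  simp only [toVA_cur_mul, apply_ite (toVA N k), map_zero]
  rfl

/-- A subspace which contains the vacuum and is stable under translation and under `e_{pq}[-1]` for
`p ≥ q ≥ m` contains the coefficients of the column-determinant of the block starting at `m`. -/
lemma trailState_mem (S : Submodule ℂ (VA N k)) (hv : vacA N k ∈ S)
    (ht : ∀ v ∈ S, transl N k v ∈ S) {m : ℕ}
    (he : ∀ p q : Fin N, m ≤ q.val → q ≤ p → ∀ v ∈ S, evenMode k (-1) (eB p q) • v ∈ S)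
    (hm : m ≤ N) (n : ℕ) : trailState N k m n ∈ S := by
  refine downward_induction
    (P := fun m' => m ≤ m' → ∀ n, trailState N k m' n ∈ S) (fun _ n => ?_) (fun m' ih hm' n => ?_)
    hm le_rfl n
  · rw [trailState_self]
    split_ifs
    exacts [hv, S.zero_mem]
  · have h1 := ih (m' + 1) (by omega) (by omega) (by omega)
    rw [trailState_rec]
    refine S.add_mem (S.add_mem ?_ (S.smul_mem _ (ht _ (h1 n)))) (S.sum_mem fun j _ => ?_)
    · split_ifs
      exacts [S.zero_mem, h1 _]
    · rcases lt_or_ge j m' with h | h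
      · rw [eB_of_lt h, evenMode_zero, zero_smul]
        exact S.zero_mem
      · have : m'.val ≤ j.val := h
        exact he _ _ hm' h _ (ih _ (by omega) (by omega) (by omega) n)

lemma smul_smul_comm (a : UA N k) (c : ℂ) (v : VA N k) : a • c • v = c • a • v :=
  smul_comm a c v

/-- The nonnegative modes of `x` kill the block starting at `m` if `x` commutes with the entries of
this block and is orthogonal to them. -/
lemma evenMode_trailState (x : lowerTri N) {m : ℕ} (hm : m ≤ N)
    (h1 : ∀ p q : Fin N, m ≤ q.val → q ≤ p → ⁅x, eB p q⁆ = 0)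
    (h2 : ∀ p q : Fin N, m ≤ q.val → q ≤ p → (formB N k).form x (eB p q) = 0)
    {s : ℤ} (hs : 0 ≤ s) (n : ℕ) : evenMode k s x • trailState N k m n = 0 := by
  let S : Submodule ℂ (VA N k) :=
    { carrier := {v | ∀ s : ℤ, 0 ≤ s → evenMode k s x • v = 0}
      add_mem' := fun {a b} ha hb s hs => by rw [smul_add, ha s hs, hb s hs, add_zero]
      zero_mem' := fun s _ => smul_zero _
      smul_mem' := fun c a ha s hs => by rw [smul_smul_comm, ha s hs, smul_zero] }
  refine trailState_mem S (fun s hs => evenMode_vac hs x) (fun v hv s hs => ?_)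
    (fun p q hq hqp v hv s hs => ?_) hm n s hs
  · have h := transl_evenMode s x v
    rw [hv s hs, map_zero] at h
    rcases hs.eq_or_lt with rfl | h0
    · simpa using h.symm
    · rw [hv (s - 1) (by omega), smul_zero, add_zero] at h
      exact h.symm
  · rw [evenMode_evenMode, hv s hs, h1 p q hq hqp, h2 p q hq hqp, evenMode_zero, mul_zero, ite_self,
      smul_zero, zero_smul, zero_smul, add_zero, add_zero]

/-- The nonnegative modes of `y` kill the block starting at `m` if `y` commutes with the entries of
this block. -/
lemma oddMode_trailState (y : strictTri N) {m : ℕ} (hm : m ≤ N)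
    (h1 : ∀ p q : Fin N, m ≤ q.val → q ≤ p → ⁅eB p q, y⁆ = 0)
    {s : ℤ} (hs : 0 ≤ s) (n : ℕ) : oddMode k s y • trailState N k m n = 0 := by
  let S : Submodule ℂ (VA N k) :=
    { carrier := {v | ∀ s : ℤ, 0 ≤ s → oddMode k s y • v = 0}
      add_mem' := fun {a b} ha hb s hs => by rw [smul_add, ha s hs, hb s hs, add_zero]
      zero_mem' := fun s _ => smul_zero _
      smul_mem' := fun c a ha s hs => by rw [smul_smul_comm, ha s hs, smul_zero] }
  refine trailState_mem S (fun s hs => oddMode_vac hs y) (fun v hv s hs => ?_)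
    (fun p q hq hqp v hv s hs => ?_) hm n s hs
  · have h := transl_oddMode s y v
    rw [hv s hs, map_zero] at h
    rcases hs.eq_or_lt with rfl | h0
    · simpa using h.symm
    · rw [hv (s - 1) (by omega), smul_zero, add_zero] at h
      exact h.symm
  · have h := evenMode_oddMode (-1) s (eB p q) y v
    rw [hv s hs, h1 p q hq hqp, oddMode_zero, zero_smul, add_zero, smul_zero] at h
    exact h.symm

/-- All modes `x[s]` with `s` large kill a given vector; this makes the sums in the normally ordered
products finite. -/
lemma evenMode_trailState_eventually {m : ℕ} (hm : m ≤ N) (n : ℕ) :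
    ∃ S : ℤ, ∀ s, S ≤ s → ∀ x : lowerTri N, evenMode k s x • trailState N k m n = 0 := by
  let S : Submodule ℂ (VA N k) :=
    { carrier := {v | ∃ S : ℤ, ∀ s, S ≤ s → ∀ x : lowerTri N, evenMode k s x • v = 0}
      add_mem' := by
        rintro a b ⟨S, hS⟩ ⟨S', hS'⟩
        refine ⟨max S S', fun s hs x => ?_⟩
        rw [smul_add, hS s (le_trans (le_max_left _ _) hs), hS' s (le_trans (le_max_right _ _) hs),
          add_zero]
      zero_mem' := ⟨0, fun s _ x => smul_zero _⟩
      smul_mem' := by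
        rintro c a ⟨S, hS⟩
        exact ⟨S, fun s hs x => by rw [smul_smul_comm, hS s hs, smul_zero]⟩ }
  refine trailState_mem S ⟨0, fun s hs x => evenMode_vac hs x⟩ ?_ ?_ hm n
  · rintro v ⟨S, hS⟩
    refine ⟨S + 1, fun s hs x => ?_⟩
    have h := transl_evenMode s x v
    rw [hS s (by omega), hS (s - 1) (by omega), map_zero, smul_zero, add_zero] at h
    exact h.symm
  · rintro p q - - v ⟨S, hS⟩
    refine ⟨max (S + 1) 2, fun s hs x => ?_⟩
    have h1 := le_trans (le_max_left _ _) hs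
    have h2 := le_trans (le_max_right _ _) hs
    rw [evenMode_evenMode, hS s (by omega), hS _ (by omega), if_neg (by omega), smul_zero,
      zero_smul, add_zero, add_zero]

lemma psi_trailState {a i : Fin N} {m : ℕ} (hm : m ≤ N) (ha : a.val < m) {s : ℤ} (hs : 0 ≤ s)
    (n : ℕ) : oddMode k s (eM a i) • trailState N k m n = 0 := by
  rcases lt_or_ge i a with h | h
  · have h' : i.val < a.val := h
    refine oddMode_trailState _ hm (fun p q hq hqp => eB_lie_eM_eq_zero ?_ ?_) hs n
    · rintro rfl
      omega
    · have : q.val ≤ p.val := hqp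
      rintro rfl
      omega
  · rw [eM_of_le h, oddMode_zero, zero_smul]

lemma offDiag_trailState {a i : Fin N} {m : ℕ} (hm : m ≤ N) (ha : a.val < m) (hi : i < a) {s : ℤ}
    (hs : 0 ≤ s) (n : ℕ) : evenMode k s (eB a i) • trailState N k m n = 0 := by
  have h' : i.val < a.val := hi
  refine evenMode_trailState _ hm (fun p q hq hqp => eB_lie_eq_zero ?_ ?_)
    (fun p q hq hqp => formB_offDiag hi.ne _) hs n
  · have : q.val ≤ p.val := hqp
    rintro rfl
    omega
  · rintro rfl
    omega

lemma diag_trailState {a b : Fin N} {m : ℕ} (hm : m ≤ N) (ha : a.val < m) (hb : b.val < m) {s : ℤ}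
    (hs : 0 ≤ s) (n : ℕ) :
    evenMode k s (eB a a) • trailState N k m n = evenMode k s (eB b b) • trailState N k m n := by
  rw [← sub_eq_zero, ← sub_smul, ← evenMode_sub]
  have key : ∀ {c p q : Fin N}, c.val < m → m ≤ q.val → q ≤ p →
      ⁅eB c c, eB p q⁆ = 0 ∧ (eB p q).1 c c = 0 := by
    intro c p q hc hq hqp
    have : q.val ≤ p.val := hqp
    have h1 : c ≠ p := by rintro rfl; omega
    have h2 : q ≠ c := by rintro rfl; omega
    exact ⟨eB_lie_eq_zero h1 h2, by rw [eB_apply, if_neg fun h => h2 h.1.2]⟩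
  refine evenMode_trailState _ hm (fun p q hq hqp => ?_) (fun p q hq hqp => ?_) hs n
  · rw [sub_lie, (key ha hq hqp).1, (key hb hq hqp).1, sub_zero]
  · exact formB_diag_sub (key ha hq hqp).2 (key hb hq hqp).2

end TrailingVectors

section Fields

variable (N k) in
/-- `HasProd p a w z` says that the state `a` of parity `p` has a field with `a_(-1) w = z`. -/
def HasProd (p : ZMod 2) (a w z : VA N k) : Prop := ∃ A, IsField N k p a A ∧ A (-1) w = z

variable {p : ZMod 2} {a b w z z' : VA N k}

lemma HasProd.add (h : HasProd N k p a w z) (h' : HasProd N k p b w z') :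
    HasProd N k p (a + b) w (z + z') := by
  obtain ⟨A, hA, rfl⟩ := h
  obtain ⟨B, hB, rfl⟩ := h'
  exact ⟨_, hA.add hB, rfl⟩

lemma HasProd.smul (c : ℂ) (h : HasProd N k p a w z) : HasProd N k p (c • a) w (c • z) := by
  obtain ⟨A, hA, rfl⟩ := h
  exact ⟨_, hA.smul c, rfl⟩

lemma HasProd.sub (h : HasProd N k p a w z) (h' : HasProd N k p b w z') :
    HasProd N k p (a - b) w (z - z') := by
  rw [sub_eq_add_neg, sub_eq_add_neg, ← neg_one_smul ℂ b, ← neg_one_smul ℂ z']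
  exact h.add (h'.smul _)

lemma HasProd.odd (y : strictTri N) (w : VA N k) :
    HasProd N k 1 (oddMode k (-1) y • vacA N k) w (oddMode k (-1) y • w) :=
  ⟨_, IsField.odd y, rfl⟩

lemma HasProd.zero (w : VA N k) : HasProd N k 1 0 w 0 := by
  have h := HasProd.odd (k := k) (0 : strictTri N) w
  rwa [oddMode_zero, zero_smul, zero_smul] at h

lemma HasProd.sum {ι : Type*} (s : Finset ι) (f g : ι → VA N k)
    (h : ∀ i ∈ s, HasProd N k 1 (f i) w (g i)) :
    HasProd N k 1 (∑ i ∈ s, f i) w (∑ i ∈ s, g i) := by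
  induction s using Finset.cons_induction with
  | empty => exact HasProd.zero w
  | cons i s hi ih =>
    rw [Finset.sum_cons, Finset.sum_cons]
    exact (h i (Finset.mem_cons_self i s)).add
      (ih fun j hj => h j (Finset.mem_cons_of_mem hj))

lemma HasProd.odd_deriv (y : strictTri N) (w : VA N k) :
    HasProd N k 1 (oddMode k (-2) y • vacA N k) w (oddMode k (-2) y • w) := by
  have h := (IsField.odd (k := k) y).deriv
  rw [transl_oddMode, transl_vac, smul_zero, zero_add] at h
  refine ⟨_, by simpa using h, by simp⟩

variable (N k) in
/-- The correction `∑ₛ y[-2-s] x[s] w`, over `s ≥ 0`, by which `(x[-1] y[-1] |0⟩)_(-1) w` differs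
from `x[-1] y[-1] w` when the nonnegative modes of `y` kill `w`. As a `finsum` it is meaningful
because `x[s] w = 0` for large `s`. -/
def normalCorr (x : lowerTri N) (y : strictTri N) (w : VA N k) : VA N k :=
  ∑ᶠ s : ℕ, oddMode k (-2 - s) y • evenMode k s x • w

lemma HasProd.even_odd (x : lowerTri N) (y : strictTri N)
    (hy : ∀ s : ℤ, 0 ≤ s → oddMode k s y • w = 0) :
    HasProd N k 1 (evenMode k (-1) x • oddMode k (-1) y • vacA N k) w
      (evenMode k (-1) x • oddMode k (-1) y • w + normalCorr N k x y w) := by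
  have h := (IsField.even (k := k) x).normal (IsField.odd y)
  rw [zero_add] at h
  refine ⟨_, h, ?_⟩
  have h1 : ∑ᶠ j : ℕ, evenMode k (-1 - j) x • oddMode k (-1 + j) y • w =
      evenMode k (-1) x • oddMode k (-1) y • w := by
    rw [finsum_eq_single _ 0]
    · simp
    · intro j hj
      rw [hy _ (by omega), smul_zero]
  simp only [zero_mul, paritySign, if_true, one_smul]
  rw [h1]
  rfl

/-- The product in the opposite order has the same correction: in the sum `∑ y[-1-s] x[-1+s] w` the
term `s = 0` is the naive product, and the other terms are those of the correction, shifted by one. -/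
lemma HasProd.odd_even (x : lowerTri N) (y : strictTri N)
    (hy : ∀ s : ℤ, 0 ≤ s → oddMode k s y • w = 0)
    (hx : ∃ S : ℤ, ∀ s, S ≤ s → evenMode k s x • w = 0) :
    HasProd N k 1 (oddMode k (-1) y • evenMode k (-1) x • vacA N k) w
      (oddMode k (-1) y • evenMode k (-1) x • w + normalCorr N k x y w) := by
  have h := (IsField.odd (k := k) y).normal (IsField.even x)
  rw [add_zero] at h
  refine ⟨_, h, ?_⟩
  obtain ⟨S, hS⟩ := hx
  obtain ⟨M, hM⟩ : ∃ M : ℕ, S ≤ M := ⟨S.toNat, Int.self_le_toNat S⟩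
  have h1 : ∑ᶠ j : ℕ, oddMode k (-1 - j) y • evenMode k (-1 + j) x • w =
      oddMode k (-1) y • evenMode k (-1) x • w + normalCorr N k x y w := by
    rw [normalCorr, finsum_eq_sum_of_support_subset (s := Finset.range (M + 1)),
      finsum_eq_sum_of_support_subset (s := Finset.range M), Finset.sum_range_succ', add_comm]
    · refine congrArg₂ _ (by simp) (Finset.sum_congr rfl fun j _ => ?_)
      rw [show (-1 : ℤ) - (j + 1 : ℕ) = -2 - j by push_cast; ring,
        show (-1 : ℤ) + (j + 1 : ℕ) = j by push_cast; ring]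
    · intro j hj
      by_contra hc
      rw [Finset.mem_coe, Finset.mem_range, not_lt] at hc
      refine hj ?_
      beta_reduce
      rw [hS _ (by omega), smul_zero]
    · intro j hj
      by_contra hc
      rw [Finset.mem_coe, Finset.mem_range, not_lt] at hc
      refine hj ?_
      beta_reduce
      rw [hS _ (by omega), smul_zero]
  have h2 : ∑ᶠ j : ℕ, evenMode k (-1 - 1 - j) x • oddMode k j y • w = 0 :=
    finsum_eq_zero_of_forall_eq_zero fun j => by rw [hy _ (by omega), smul_zero]
  simp only [mul_zero, paritySign, if_true, one_smul]
  rw [h1, h2, add_zero]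

end Fields

end

/-! ### The differential of the block determinants -/

section

variable {N : ℕ} {k : ℂ}

section Differential

lemma psi_zero (j i : Fin N) : psi k j i 0 = oddMode k (-1) (eM j i) := rfl

lemma psi_neg_one (j i : Fin N) : psi k j i (-1) = oddMode k (-2) (eM j i) := rfl

lemma BRSTGraph.zero : BRSTGraph N k 0 0 := by
  simpa using BRSTGraph.smul (0 : ℂ) (BRSTGraph.vac (N := N) (k := k))

lemma BRSTGraph.sum {ι : Type*} (s : Finset ι) (f g : ι → VA N k)
    (h : ∀ i ∈ s, BRSTGraph N k (f i) (g i)) : BRSTGraph N k (∑ i ∈ s, f i) (∑ i ∈ s, g i) := by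
  induction s using Finset.cons_induction with
  | empty => exact BRSTGraph.zero
  | cons i s hi ih =>
    rw [Finset.sum_cons, Finset.sum_cons]
    exact (h i (Finset.mem_cons_self i s)).add (ih fun j hj => h j (Finset.mem_cons_of_mem hj))

lemma normalCorr_congr {x x' : lowerTri N} {w : VA N k} (y : strictTri N)
    (h : ∀ s : ℤ, 0 ≤ s → evenMode k s x • w = evenMode k s x' • w) :
    normalCorr N k x y w = normalCorr N k x' y w :=
  finsum_congr fun s => by rw [h s (by omega)]

lemma normalCorr_eq_zero {x : lowerTri N} {w : VA N k} (y : strictTri N)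
    (h : ∀ s : ℤ, 0 ≤ s → evenMode k s x • w = 0) : normalCorr N k x y w = 0 :=
  finsum_eq_zero_of_forall_eq_zero fun s => by rw [h s (by omega), smul_zero]

variable (k) in
/-- The value on `w` of the naive operator obtained from the formula for `Q e_{ji}[-1]` by letting
the modes act one after another. -/
def naiveQ (j i : Fin N) (w : VA N k) : VA N k :=
  ∑ a, evenMode k (-1) (eB a i) • psi k j a 0 • w - ∑ a, psi k a i 0 • evenMode k (-1) (eB j a) • w
    + alpha N k • psi k j i (-1) • w + ∑ a with a.val = j.val + 1, psi k a i 0 • w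
    - ∑ a with a.val + 1 = i.val, psi k j a 0 • w

lemma naiveQ_of_lt {j i : Fin N} (h : j < i) (w : VA N k) : naiveQ k j i w = 0 := by
  have h' : j.val < i.val := h
  have h1 : ∀ a, evenMode k (-1) (eB a i) • psi k j a 0 • w = 0 := by
    intro a
    rcases lt_or_ge a i with ha | ha
    · rw [eB_of_lt ha, evenMode_zero, zero_smul]
    · rw [psi_zero, eM_of_le (h.le.trans ha), oddMode_zero, zero_smul, smul_zero]
  have h2 : ∀ a, psi k a i 0 • evenMode k (-1) (eB j a) • w = 0 := by
    intro a
    rcases lt_or_ge j a with ha | ha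
    · rw [eB_of_lt ha, evenMode_zero, zero_smul, smul_zero]
    · rw [psi_zero, eM_of_le (ha.trans h.le), oddMode_zero, zero_smul]
  have h3 : ∑ a : Fin N with a.val = j.val + 1, psi k a i 0 • w = 0 := by
    refine Finset.sum_eq_zero fun a ha => ?_
    have ha' := (Finset.mem_filter.1 ha).2
    have : a ≤ i := by
      rw [Fin.le_def]
      omega
    rw [psi_zero, eM_of_le this, oddMode_zero, zero_smul]
  have h4 : ∑ a : Fin N with a.val + 1 = i.val, psi k j a 0 • w = 0 := by
    refine Finset.sum_eq_zero fun a ha => ?_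
    have ha' := (Finset.mem_filter.1 ha).2
    have : j ≤ a := by
      rw [Fin.le_def]
      omega
    rw [psi_zero, eM_of_le this, oddMode_zero, zero_smul]
  simp only [naiveQ, h1, h2, h3, h4, psi_neg_one, eM_of_le h.le, oddMode_zero, zero_smul,
    Finset.sum_const_zero, smul_zero, sub_zero, add_zero]

/-- On the blocks after `j` the `(-1)`-product with `Q e_{ji}[-1]` has no normal ordering
corrections: the off-diagonal ones vanish, and those from `e_{ii} ψ_{ji}` and `ψ_{ji} e_{jj}`
cancel. -/
lemma hasProd_naiveQ {j i : Fin N} (h : i ≤ j) (n : ℕ) :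
    HasProd N k 1
      (∑ a with i ≤ a ∧ a < j, evenMode k (-1) (eB a i) • psi k j a 0 • vacA N k
        - ∑ a with i < a ∧ a ≤ j, psi k a i 0 • evenMode k (-1) (eB j a) • vacA N k
        + alpha N k • psi k j i (-1) • vacA N k
        + ∑ a with a.val = j.val + 1, psi k a i 0 • vacA N k
        - ∑ a with a.val + 1 = i.val, psi k j a 0 • vacA N k)
      (trailState N k (j + 1) n) (naiveQ k j i (trailState N k (j + 1) n)) := by
  have hj : j.val + 1 ≤ N := j.2
  set w := trailState N k (j + 1) n
  have hpsi : ∀ a b : Fin N, a ≤ j → ∀ s : ℤ, 0 ≤ s → oddMode k s (eM a b) • w = 0 :=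
    fun a b ha s hs => psi_trailState hj (Nat.lt_succ_of_le ha) hs n
  have hfin : ∀ x : lowerTri N, ∃ S : ℤ, ∀ s, S ≤ s → evenMode k s x • w = 0 := by
    intro x
    obtain ⟨S, hS⟩ := evenMode_trailState_eventually (k := k) hj n
    exact ⟨S, fun s hs => hS s hs x⟩
  have hprod := ((((HasProd.sum (Finset.univ.filter fun a => i ≤ a ∧ a < j) _ _ fun a _ =>
    HasProd.even_odd (eB a i) (eM j a) (hpsi j a le_rfl)).sub
    (HasProd.sum (Finset.univ.filter fun a => i < a ∧ a ≤ j) _ _ fun a ha =>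
      HasProd.odd_even (eB j a) (eM a i) (hpsi a i (Finset.mem_filter.1 ha).2.2) (hfin _))).add
    ((HasProd.odd_deriv (eM j i) w).smul (alpha N k))).add
    (HasProd.sum (Finset.univ.filter fun a : Fin N => a.val = j.val + 1) _ _ fun a _ =>
      HasProd.odd (eM a i) w)).sub
    (HasProd.sum (Finset.univ.filter fun a : Fin N => a.val + 1 = i.val) _ _ fun a _ =>
      HasProd.odd (eM j a) w)
  have hcorr : ∑ a with i ≤ a ∧ a < j, normalCorr N k (eB a i) (eM j a) w =
      ∑ a with i < a ∧ a ≤ j, normalCorr N k (eB j a) (eM a i) w := by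
    rcases h.eq_or_lt with rfl | hlt
    · rw [Finset.filter_false_of_mem (fun a _ h => absurd (h.1.trans_lt h.2) (lt_irrefl _)),
        Finset.filter_false_of_mem (fun a _ h => absurd (h.1.trans_le h.2) (lt_irrefl _)),
        Finset.sum_empty, Finset.sum_empty]
    · rw [Finset.sum_eq_single_of_mem i (Finset.mem_filter.2 ⟨Finset.mem_univ i, le_rfl, hlt⟩),
        Finset.sum_eq_single_of_mem j (Finset.mem_filter.2 ⟨Finset.mem_univ j, hlt, le_rfl⟩)]
      · exact normalCorr_congr _ fun s hs =>
          diag_trailState hj (Nat.lt_succ_of_lt hlt) (Nat.lt_succ_self _) hs n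
      · intro a ha haj
        have ha' := (Finset.mem_filter.1 ha).2
        exact normalCorr_eq_zero _ fun s hs =>
          offDiag_trailState hj (Nat.lt_succ_self _) (lt_of_le_of_ne ha'.2 haj) hs n
      · intro a ha hai
        have ha' := (Finset.mem_filter.1 ha).2
        exact normalCorr_eq_zero _ fun s hs =>
          offDiag_trailState hj (Nat.lt_succ_of_lt ha'.2) (lt_of_le_of_ne ha'.1 hai.symm) hs n
  have h1 : ∑ a with i ≤ a ∧ a < j, evenMode k (-1) (eB a i) • psi k j a 0 • w =
      ∑ a, evenMode k (-1) (eB a i) • psi k j a 0 • w := by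
    refine Finset.sum_filter_of_ne fun a _ ha => ?_
    by_contra hc
    refine ha ?_
    rcases lt_or_ge a i with hai | hai
    · rw [eB_of_lt hai, evenMode_zero, zero_smul]
    · rw [psi_zero, eM_of_le (not_lt.1 fun h' => hc ⟨hai, h'⟩), oddMode_zero, zero_smul, smul_zero]
  have h2 : ∑ a with i < a ∧ a ≤ j, psi k a i 0 • evenMode k (-1) (eB j a) • w =
      ∑ a, psi k a i 0 • evenMode k (-1) (eB j a) • w := by
    refine Finset.sum_filter_of_ne fun a _ ha => ?_
    by_contra hc
    refine ha ?_
    rcases lt_or_ge j a with haj | haj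
    · rw [eB_of_lt haj, evenMode_zero, zero_smul, smul_zero]
    · rw [psi_zero, eM_of_le (not_lt.1 fun h' => hc ⟨h', haj⟩), oddMode_zero, zero_smul]
  rw [Finset.sum_add_distrib, Finset.sum_add_distrib, hcorr, add_sub_add_right_eq_sub] at hprod
  rw [naiveQ, ← h1, ← h2]
  exact hprod

lemma brst_eB_trailState (j i : Fin N) (n : ℕ) {u : VA N k}
    (hu : i ≤ j → BRSTGraph N k (trailState N k (j + 1) n) u) :
    BRSTGraph N k (evenMode k (-1) (eB j i) • trailState N k (j + 1) n)
      (naiveQ k j i (trailState N k (j + 1) n) + evenMode k (-1) (eB j i) • u) := by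
  rcases lt_or_ge j i with h | h
  · rw [eB_of_lt h, evenMode_zero, zero_smul, zero_smul, naiveQ_of_lt h, add_zero]
    exact BRSTGraph.zero
  · obtain ⟨A, hA, hz⟩ := hasProd_naiveQ (k := k) h n
    rw [← zero_add (1 : ZMod 2)] at hA
    have h1 := BRSTGraph.mul (BRSTGraph.even j i h) (hu h) (IsField.even (eB j i)) hA
    rw [hz] at h1
    simpa only [paritySign, if_true, one_smul] using h1

variable (N k) in
/-- The sum `∑_j ψ_{j,m-1}[0] w_{j+1}`, where `w_{j+1}` is the coefficient of `Tⁿ` in the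
column-determinant of the block after `j`. It is empty for `m = 0`. -/
def trailPsi (m n : ℕ) : VA N k :=
  ∑ p : Fin N with p.val + 1 = m, ∑ j, psi k j p 0 • trailState N k (j + 1) n

lemma trailPsi_succ (m : Fin N) (n : ℕ) :
    trailPsi N k (m + 1) n = ∑ j, psi k j m 0 • trailState N k (j + 1) n := by
  rw [trailPsi, Finset.sum_eq_single_of_mem m (by simp)]
  intro p hp hpm
  have := (Finset.mem_filter.1 hp).2
  exact absurd (Fin.ext (by omega)) hpm

/-- The identity which makes the recursion for `Q` of the block determinants close up. -/
lemma trailPsi_rec (m : Fin N) (n : ℕ) :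
    -trailPsi N k m n = (if n = 0 then 0 else -trailPsi N k (m + 1) (n - 1)) +
      alpha N k • transl N k (-trailPsi N k (m + 1) n) +
      ∑ j : Fin N, (naiveQ k j m (trailState N k (j + 1) n) +
        evenMode k (-1) (eB j m) • -trailPsi N k (j + 1) n) := by
  set y : Fin N → VA N k := fun j => trailState N k (j + 1) n with hy
  set y' : Fin N → VA N k := fun j => if n = 0 then 0 else trailState N k (j + 1) (n - 1) with hy'
  have e1 : ∑ j, ∑ a, evenMode k (-1) (eB a m) • psi k j a 0 • y j =
      ∑ j : Fin N, evenMode k (-1) (eB j m) • trailPsi N k (j + 1) n := by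
    rw [Finset.sum_comm]
    refine Finset.sum_congr rfl fun a _ => ?_
    rw [trailPsi_succ, Finset.smul_sum]
  have e2 : ∑ j : Fin N, ∑ a : Fin N with a.val = j.val + 1, psi k a m 0 • y j =
      ∑ a : Fin N, psi k a m 0 • trailState N k a n := by
    simp only [Finset.sum_filter]
    rw [Finset.sum_comm]
    refine Finset.sum_congr rfl fun a _ => ?_
    -- No `j` precedes `a = 0`, but `ψ_{am}` vanishes then.
    rcases Nat.eq_zero_or_pos a.val with ha | ha
    · have h0 : psi k a m 0 = 0 := by
        rw [psi_zero, eM_of_le (Fin.le_def.2 (by omega)), oddMode_zero]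
      simp [h0]
    · rw [Finset.sum_eq_single ⟨a.val - 1, by omega⟩]
      · rw [if_pos (by simp; omega), hy]
        simp only
        rw [Nat.sub_add_cancel ha]
      · intro j _ hj
        exact if_neg fun h => hj (Fin.ext (by simp; omega))
      · simp
  have e3 : ∑ a : Fin N, psi k a m 0 • trailState N k a n = ∑ a, psi k a m 0 • y' a +
      alpha N k • ∑ a, psi k a m 0 • transl N k (y a) +
      ∑ j, ∑ a, psi k a m 0 • evenMode k (-1) (eB j a) • y j := by
    rw [Finset.sum_comm, Finset.smul_sum, ← Finset.sum_add_distrib, ← Finset.sum_add_distrib]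
    refine Finset.sum_congr rfl fun a _ => ?_
    rw [trailState_rec, smul_add, smul_add, smul_smul_comm, Finset.smul_sum]
  have e4 : transl N k (trailPsi N k (m + 1) n) =
      ∑ a, psi k a m 0 • transl N k (y a) + ∑ a, psi k a m (-1) • y a := by
    rw [trailPsi_succ, map_sum, ← Finset.sum_add_distrib]
    refine Finset.sum_congr rfl fun a _ => ?_
    rw [psi_zero, transl_oddMode]
    simp [psi_neg_one, hy]
  have e5 : (if n = 0 then 0 else -trailPsi N k (m + 1) (n - 1)) = -∑ a, psi k a m 0 • y' a := by
    rw [trailPsi_succ]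
    split_ifs with h0
    · simp [hy', h0]
    · simp only [hy', h0, if_false]
  have e6 : ∑ j, ∑ a : Fin N with a.val + 1 = m.val, psi k j a 0 • y j = trailPsi N k m n := by
    rw [Finset.sum_comm, trailPsi]
  have e7 : ∑ j : Fin N, (naiveQ k j m (y j) + evenMode k (-1) (eB j m) • -trailPsi N k (j + 1) n) =
      ∑ j, ∑ a, evenMode k (-1) (eB a m) • psi k j a 0 • y j -
        ∑ j, ∑ a, psi k a m 0 • evenMode k (-1) (eB j a) • y j +
        alpha N k • ∑ a, psi k a m (-1) • y a +
        ∑ j : Fin N, ∑ a : Fin N with a.val = j.val + 1, psi k a m 0 • y j -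
        ∑ j, ∑ a : Fin N with a.val + 1 = m.val, psi k j a 0 • y j -
        ∑ j : Fin N, evenMode k (-1) (eB j m) • trailPsi N k (j + 1) n := by
    simp only [naiveQ, smul_neg, Finset.sum_add_distrib,
      Finset.sum_neg_distrib, Finset.smul_sum, sub_eq_add_neg]
  rw [e7, e1, e2, e3, e6, e5, map_neg, e4]
  module

/-- The differential of the column-determinant of the block starting at `m` only involves the
elements `ψ_{j,m-1}`, which connect the block to the place before it. -/
lemma brst_trailState {m : ℕ} (hm : m ≤ N) (n : ℕ) :
    BRSTGraph N k (trailState N k m n) (-trailPsi N k m n) := by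
  refine downward_induction
    (P := fun m => ∀ n, BRSTGraph N k (trailState N k m n) (-trailPsi N k m n)) (fun n => ?_)
    (fun m ih n => ?_) hm n
  · have h0 : trailPsi N k N n = 0 := by
      refine Finset.sum_eq_zero fun p hp => Finset.sum_eq_zero fun j _ => ?_
      have := (Finset.mem_filter.1 hp).2
      rw [psi_zero, eM_of_le (Fin.le_def.2 (by omega)), oddMode_zero, zero_smul]
    rw [h0, neg_zero, trailState_self]
    split_ifs
    exacts [BRSTGraph.vac, BRSTGraph.zero]
  · have h1 := ih (m + 1) (by omega) (by omega)
    rw [trailState_rec, trailPsi_rec]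
    refine ((?_ : BRSTGraph N k _ _).add ((h1 n).transl.smul _)).add
      (BRSTGraph.sum _ _ _ fun j _ => brst_eB_trailState j m n fun hj => ?_)
    · split_ifs
      exacts [BRSTGraph.zero, h1 _]
    · have : m.val ≤ j.val := hj
      exact ih (j + 1) (by omega) (by omega) n

lemma trailPsi_zero (n : ℕ) : trailPsi N k 0 n = 0 := by
  simp [trailPsi]

end Differential

end

/-! ### Projection to the diagonal and the theorem -/

section

section Diagonal

variable {R : Type*} [Ring R]

/-- If the entries below the diagonal vanish, the column-determinant is the ordered product of the
diagonal entries. -/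
lemma trailDet_diagonal (T : R) {N : ℕ} (e : Fin N → Fin N → R) (he : ∀ i j, i ≠ j → e i j = 0) :
    trailDet T N e 0 = (List.ofFn fun i => T + e i i).prod := by
  induction N with
  | zero => rw [trailDet, List.ofFn_zero, List.prod_nil]
  | succ N ih =>
    have h := trailDet_rec T e (fun i j hij => he i j hij.ne) 0
    rw [Fin.val_zero] at h
    rw [h, Finset.sum_eq_single 0 (fun j _ hj => by rw [he j 0 hj, zero_mul]) (by simp),
      Fin.val_zero, ← add_mul, zero_add, trailDet,
      ih _ fun i j hij => he _ _ fun h' => hij (Fin.succ_injective _ h'), List.ofFn_succ,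
      List.prod_cons]

variable {A A' : Type*} [Ring A] [Algebra ℂ A] [Ring A'] [Algebra ℂ A']

/-- A homomorphism intertwining the derivations commutes with the coefficients of the
column-determinants. -/
lemma map_coeff_trailDet {δ : AlgDer A} {δ' : AlgDer A'} (F : A →ₐ[ℂ] A')
    (hF : ∀ a, F (δ.toLin a) = δ'.toLin (F a)) {N : ℕ} {e : Fin N → Fin N → A}
    (he : ∀ i j, i < j → e i j = 0) {m : ℕ} (hm : m ≤ N) (n : ℕ) :
    F ((trailDet (DiffPoly.tau δ) N (fun i j => DiffPoly.const δ (e i j)) m).coeff n) =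
      (trailDet (DiffPoly.tau δ') N (fun i j => DiffPoly.const δ' (F (e i j))) m).coeff n := by
  refine downward_induction (P := fun m => ∀ n,
    F ((trailDet (DiffPoly.tau δ) N (fun i j => DiffPoly.const δ (e i j)) m).coeff n) =
      (trailDet (DiffPoly.tau δ') N (fun i j => DiffPoly.const δ' (F (e i j))) m).coeff n)
    (fun n => ?_) (fun m ih n => ?_) hm n
  · rw [trailDet_self, trailDet_self, DiffPoly.coeff_one, DiffPoly.coeff_one, apply_ite F, map_one,
      map_zero]
  · rw [DiffPoly.coeff_trailDet he,
      DiffPoly.coeff_trailDet (e := fun i j => F (e i j)) (fun i j h => by rw [he i j h, map_zero]),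
      map_add, map_add, map_sum, apply_ite F, map_zero, hF, ih (m + 1) (by omega) (by omega),
      ih (m + 1) (by omega) (by omega)]
    refine congrArg _ (Finset.sum_congr rfl fun j _ => ?_)
    rw [map_mul]
    rcases lt_or_ge j m with h | h
    · rw [he _ _ h, map_zero, zero_mul, zero_mul]
    · have : m.val ≤ j.val := h
      rw [ih (j + 1) (by omega) (by omega)]

end Diagonal

section Functoriality

variable {L L' : Type*} [LieRing L] [LieAlgebra ℂ L] [LieRing L'] [LieAlgebra ℂ L']
  (κ : InvForm L) (κ' : InvForm L') (f : L →ₗ⁅ℂ⁆ L')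
  (hf : ∀ x y, κ'.form (f x) (f y) = κ.form x y)

/-- The homomorphism `L[t⁻¹]t⁻¹ → L'[t⁻¹]t⁻¹` induced by a homomorphism of Lie algebras with
forms. -/
def negMap : negPart κ →ₗ⁅ℂ⁆ negPart κ' where
  toFun u := ⟨affMap κ κ' f hf u.1, by
    obtain ⟨u, hu⟩ := u
    change _ ∈ Submodule.span ℂ _
    induction hu using Submodule.span_induction with
    | zero => rw [map_zero]; exact Submodule.zero_mem _
    | add a b _ _ ha hb => rw [map_add]; exact Submodule.add_mem _ ha hb
    | smul c a _ ha => rw [map_smul]; exact Submodule.smul_mem _ _ ha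
    | mem a ha =>
      obtain ⟨r, hr, x, rfl⟩ := ha
      exact Submodule.subset_span ⟨r, hr, f x, rfl⟩⟩
  map_add' u v := Subtype.ext (map_add (affMap κ κ' f hf) u.1 v.1)
  map_smul' c u := Subtype.ext (map_smul (affMap κ κ' f hf) c u.1)
  map_lie' {u v} := Subtype.ext (LieHom.map_lie (affMap κ κ' f hf) u.1 v.1)

/-- The homomorphism `U(L[t⁻¹]t⁻¹) → U(L'[t⁻¹]t⁻¹)` induced by a homomorphism of Lie algebras with
forms. -/
def unegMap : UNeg κ →ₐ[ℂ] UNeg κ' :=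
  UniversalEnvelopingAlgebra.lift ℂ
    ((UniversalEnvelopingAlgebra.ι ℂ).comp (negMap κ κ' f hf))

lemma unegMap_negMode (r : ℤ) (hr : r < 0) (x : L) :
    unegMap κ κ' f hf (UniversalEnvelopingAlgebra.ι ℂ (negMode κ r hr x)) =
      UniversalEnvelopingAlgebra.ι ℂ (negMode κ' r hr (f x)) := by
  rw [unegMap, UniversalEnvelopingAlgebra.lift_ι_apply, LieHom.comp_apply]
  rfl

lemma unegMap_cur (x : L) : unegMap κ κ' f hf (cur κ x) = cur κ' (f x) :=
  unegMap_negMode κ κ' f hf _ _ x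

lemma unegMap_adTau (u : UNeg κ) :
    unegMap κ κ' f hf ((adTau κ).toLin u) = (adTau κ').toLin (unegMap κ κ' f hf u) :=
  env_deriv_comm_of_negPart κ _ _ (fun r hr x => by
    rw [adTau_mode, map_smul, unegMap_negMode, unegMap_negMode, adTau_mode]) u

lemma vacMap_toVac (u : UNeg κ) :
    vacMap κ κ' f hf (UNeg.toVac κ u) = UNeg.toVac κ' (unegMap κ κ' f hf u) := by
  have h : (envMap κ κ' f hf).comp (UniversalEnvelopingAlgebra.lift ℂ
      ((UniversalEnvelopingAlgebra.ι ℂ).comp (negPart κ).incl)) =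
      (UniversalEnvelopingAlgebra.lift ℂ
        ((UniversalEnvelopingAlgebra.ι ℂ).comp (negPart κ').incl)).comp (unegMap κ κ' f hf) := by
    ext x
    simp [envMap, unegMap, negMap]
  exact congrArg (fun g => VacMod.mk κ' (g u)) h

end Functoriality

variable (N : ℕ) (k : ℂ)

lemma diagProj_eB (i j : Fin N) : diagProj N (eB i j) = if i = j then eL i else 0 := by
  refine Subtype.ext ?_
  change Matrix.diagonal (fun l => (eB i j).1 l l) = _
  ext a b
  rw [Matrix.diagonal_apply, eB_apply]
  split_ifs with h1 h2 h3 h3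
  · subst h3
    change 1 = Matrix.single i i (1 : ℂ) a b
    rw [← h1, h2.1.1, Matrix.single_apply_same]
  · exact absurd (h2.1.1.trans h2.1.2.symm) h3
  · subst h3
    change 0 = Matrix.single i i (1 : ℂ) a b
    rw [Matrix.single_apply, if_neg fun h => h2 ⟨⟨h.1, h.1⟩, le_rfl⟩]
  · rfl
  · subst ‹i = j›
    change 0 = Matrix.single i i (1 : ℂ) a b
    rw [Matrix.single_apply, if_neg fun h => h1 (h.1.symm.trans h.2)]
  · rfl

/-- The entries `e_{ij}[-1]` of `B` projected to `𝔩`. -/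
def diagCur (i j : Fin N) : UNeg (formL N k) :=
  unegMap (formB N k) (formL N k) (diagProj N) (formL_diagProj N k) (cur (formB N k) (eB i j))

lemma diagCur_of_ne (i j : Fin N) (h : i ≠ j) : diagCur N k i j = 0 := by
  rw [diagCur, unegMap_cur, diagProj_eB, if_neg h, cur_zero]

lemma diagCur_self (i : Fin N) : diagCur N k i i = cur (formL N k) (eL i) := by
  rw [diagCur, unegMap_cur, diagProj_eB, if_pos rfl]

lemma const_diagCur_of_ne (δ : AlgDer (UNeg (formL N k))) (i j : Fin N) (h : i ≠ j) :
    DiffPoly.const δ (diagCur N k i j) = 0 := by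
  rw [diagCur_of_ne N k i j h]
  exact Polynomial.C_0

lemma genW_mem (r : ℕ) : UNeg.toVac (formB N k) (genW N k r) ∈ principalW N k := by
  have h := brst_trailState (k := k) (Nat.zero_le N) (N - r)
  rw [trailPsi_zero, neg_zero, trailState, trailDet_zero] at h
  exact h

lemma miura_genW (r : ℕ) : miura N k ⟨UNeg.toVac (formB N k) (genW N k r), genW_mem N k r⟩ =
    UNeg.toVac (formL N k)
      ((trailDet (DiffPoly.tau ((adTau (formL N k)).smul (alpha N k))) N
        (fun i j => DiffPoly.const _ (diagCur N k i j)) 0).coeff (N - r)) := by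
  refine (vacMap_toVac (formB N k) (formL N k) (diagProj N) (formL_diagProj N k) _).trans ?_
  rw [genW, ← trailDet_zero]
  refine congrArg _ ?_
  refine map_coeff_trailDet _ (fun a => ?_) cur_eB_of_lt (Nat.zero_le N) _
  exact (map_smul _ _ _).trans (congrArg _ (unegMap_adTau _ _ (diagProj N) (formL_diagProj N k) a))

end

end PrincipalW
end

open PrincipalW
theorem corollary2p2 (N : ℕ) (k : ℂ) :
    genW N k 0 = 1 ∧
    cdet (matB (alpha N k • DiffPoly.tau (adTau (formB N k)))
        fun i j => DiffPoly.const _ (cur (formB N k) (eB i j))) =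
      ∑ r ∈ Finset.range (N + 1), DiffPoly.const _ (genW N k r) *
        (alpha N k • DiffPoly.tau (adTau (formB N k))) ^ (N - r) ∧
    ∃ hW : ∀ r : Fin (N + 1), UNeg.toVac (formB N k) (genW N k r) ∈ principalW N k,
      ∑ r : Fin (N + 1), miura N k ⟨UNeg.toVac (formB N k) (genW N k r), hW r⟩ ⊗ₜ[ℂ]
          ((alpha N k • (Polynomial.X : Polynomial ℂ)) ^ (N - r.val)) =
        DiffPoly.mapCoeff (UNeg.toVac (formL N k))
          (List.ofFn fun i : Fin N => alpha N k • DiffPoly.tau (adTau (formL N k)) +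
            DiffPoly.const _ (cur (formL N k) (eL i))).prod ∧
      ∑ r : Fin (N + 1), miura N k ⟨UNeg.toVac (formB N k) (genW N k r), hW r⟩ ⊗ₜ[ℂ]
          ((Polynomial.X : Polynomial ℂ) ^ (N - r.val)) =
        DiffPoly.mapCoeff (UNeg.toVac (formL N k))
          (List.ofFn fun i : Fin N => DiffPoly.tau ((adTau (formL N k)).smul (alpha N k)) +
            DiffPoly.const _ (cur (formL N k) (eL i))).prod := by
  have hB := DiffPoly.trailDet_monic (δ := (adTau (formB N k)).smul (alpha N k))
    (e := fun i j => cur (formB N k) (eB i j)) cur_eB_of_lt (Nat.zero_le N)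
  have hL := DiffPoly.trailDet_monic (δ := (adTau (formL N k)).smul (alpha N k))
    (e := diagCur N k) (fun i j h => diagCur_of_ne N k i j h.ne) (Nat.zero_le N)
  rw [Nat.sub_zero] at hB hL
  refine ⟨?_, ?_, fun r => genW_mem N k r, ?_, ?_⟩
  · rw [genW, ← trailDet_zero]
    exact hB.1
  · rw [← trailDet_zero, ← DiffPoly.substSmul_trailDet _ cur_eB_of_lt (Nat.zero_le N),
      DiffPoly.substSmul_eq_sum _ _ hB.2]
    simp only [trailDet_zero]
    rfl
  · simp only [miura_genW]
    rw [← DiffPoly.mapCoeff_substSmul _ _ _ hL.2,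
      DiffPoly.substSmul_trailDet _ (fun i j h => diagCur_of_ne N k i j h.ne) (Nat.zero_le N),
      trailDet_diagonal _ _ (const_diagCur_of_ne N k _)]
    simp only [diagCur_self]
  · simp only [miura_genW]
    rw [← DiffPoly.mapCoeff_eq_sum _ _ hL.2, trailDet_diagonal _ _ (const_diagCur_of_ne N k _)]
    simp only [diagCur_self]
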